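/- **Setting.** $n$ processes, of which an adaptive adversary may corrupt at most $f<n/3$ during the execution; a process is correct if it is never corrupted. Communication is asynchronous. Fix a domain size $D\ge 1$, a security parameter $\lambda$, a target $\delta\in(0,1)$, and a deterministic rule $\arg\max$. The processes use four ideal distributed objects; all their freedom is resolved by the adversary, and below "correct" refers to the moment of the event. * *Random Secret Draw* (two instances: tickets $T_j\in\{0,\dots,2^\lambda-1\}$ and values $V_j\in\{0,\dots,D-1\}$). All $T_j,V_j$, $j\le n$, are independent and uniform, and nothing about them is known to the adversary before a correct process enables retrieval; then everything is. Processes get notifications "$j$ has been assigned"; correct participants are eventually assigned, a notification received by one process is eventually received by all correct ones, and retrieval of assigned numbers eventually succeeds once all correct processes have enabled it. * *Gather* delivers to each process $i$ a set $S_i$ of processes for which $i$ has both notifications. There is a core of at least $n-f$ processes, fixed before the first delivery, contained in every $S_i$; every correct process eventually gets a set. * *Bundled Approximate Agreement* with $r$ rounds: given an input vector from each process, returns vectors such that each coordinate lies in the range of the inputs of correct processes and any two returned vectors differ by at most $\epsilon=2^{-r}$ in each coordinate; it terminates. **Algorithm** (process $i$). Start both draws and Gather; upon delivery of $S_i$ run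 the approximate agreement on the indicator vector of $S_i$ and obtain weights $(w_j)$; enable retrieval in both draws; retrieve $T_j,V_j$ for the candidates $\{j: w_j>0\}$; output $V_{j^*}$ with $j^*=\arg\max_{w_j>0}\mathrm{cal}(w_j)T_j$. *Calibrated version:* $r=\max\bigl(4,\,5+\lceil\log_2\frac1{1-\delta}+\log_2\log_2\frac1{1-\delta}\rceil\bigr)$; if $n>\frac32\ln\frac2{1-\delta}$, then $\mathrm{cal}(0)=0$ and $\mathrm{cal}(w)=\frac{w-\epsilon}{1-\epsilon}+\frac{1-w}{1-\epsilon}v$ for $w\ne0$, with $v=1-\frac{\ln(2/(1-\delta))}{2n/3}$; otherwise $\mathrm{cal}(w)=w$. *Uncalibrated version:* $r=3+\lceil\log_2 n+\log_2\frac1{1-\delta}\rceil$ and $\mathrm{cal}(w)=w$. **Theorem.** (a) There is an absolute constant $K$ such that, with $\nu=Kn^2/2^\lambda$ (negligible in $\lambda$), both versions implement a Monte Carlo common coin with success probability $\delta$: 1. *Termination:* in every execution in which all correct processes invoke the coin and the objects satisfy their liveness properties, every correct process outputs a value. 2. *Probabilistic consistency:* against every (randomized) adversary, with probability at least $\delta-\nu$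 no two correct processes output different values. 3. *Randomness:* against every (randomized) adversary there is a random variable, the value of the coin, which is exactly uniform over the domain, also conditionally on the adversary's random seed; the first correct process to complete the approximate agreement outputs nothing other than this value; and with probability at least $\delta-\nu$ every value output by a process that is correct at that moment equals it. Hence, if all executions are fair, the probability that a process that is always correct outputs a given value differs from $1/D$ by at most $1-\delta+\nu$. (b) Suppose that the objects have the following costs, with given constants: Random Secret Draw and Gather have $O(1)$ latency, a round of approximate agreement $O(1)$, a retrieval $O(1)$ (in message delays); per process, a draw over a domain of size $N$ and its retrieval each cost $O(n\log N+n^2\lambda)$ bits, Gather $O(n^2\lambda)$ bits, and a round of approximate agreement $O(n^2\lambda)$ bits. Then there is a constant $C$, depending only on these constants, such that for all $n$, $f<n/3$, $D$, $\lambda$ and $\delta\in[\frac12,1)$ the calibrated version satisfies: every correct process outputs at most $C\log_2\frac1{1-\delta}$ message delays after all correct processes have invoked the coin, and, if $D\le 2^{n\lambda}$, correct processes send at most $C\,n^3\lambda\log_2\frac1{1-\delta}$ bits in total. -/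

import Mathlib

open scoped ENNReal

noncomputable section

namespace MonteCarloCoin

/-! ### Parameters of the algorithm -/

/-- The parameters of the coin algorithm run by `n` processes: values are drawn in a domain of
size `D`, tickets in a domain of size `2 ^ lam` (`lam` is the security parameter). -/
structure Protocol (n D lam : ℕ) where
  /-- bound on the number of Byzantine processes -/
  f : ℕ
  /-- number of rounds of approximate agreement; the precision is `2 ^ (-rounds)` -/
  rounds : ℕ
  /-- weight calibration function -/
  calibrate : ℝ → ℝ
  /-- the rule that selects a maximizer of a function over a finite set -/
  argmax : Finset (Fin n) → (Fin n → ℝ) → Fin n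

/-- The selection rule returns an element of the set at which the function is maximal
(ties may be broken in any deterministic way). -/
def IsArgmax {n : ℕ} (am : Finset (Fin n) → (Fin n → ℝ) → Fin n) : Prop :=
  ∀ (s : Finset (Fin n)) (g : Fin n → ℝ), s.Nonempty → am s g ∈ s ∧ ∀ j ∈ s, g j ≤ g (am s g)

/-- Precision of the bundled approximate agreement. -/
def Protocol.eps {n D lam : ℕ} (P : Protocol n D lam) : ℝ := ((2 : ℝ) ^ P.rounds)⁻¹

/-- The secrets drawn by the two instances of Random Secret Draw: one ticket and one value for
every process (Byzantine or not). -/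
abbrev Secrets (n D lam : ℕ) : Type := (Fin n → Fin (2 ^ lam)) × (Fin n → Fin D)

/-! ### Global state

The processes run the algorithm on top of four distributed objects: two instances of Random
Secret Draw, one of Gather and one of Bundled Approximate Agreement. The objects may behave in
every way that their specification permits, and the adversary resolves all this freedom. -/

/-- State of an instance of Random Secret Draw. -/
structure RSDState (n : ℕ) where
  /-- `(i, j)`: process `i` has been notified that `j` has been assigned a value -/
  notified : Finset (Fin n × Fin n)
  /-- processes that invoked `EnableRetrieve` (while correct) -/
  enabled : Finset (Fin n)

/-- What the adversary knows about the drawn numbers `x`: nothing until a process that is still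
correct invokes `EnableRetrieve`, and everything from then on. -/
def RSDState.leak {n N : ℕ} (d : RSDState n) (x : Fin n → Fin N) : Option (Fin n → Fin N) :=
  open Classical in if d.enabled.Nonempty then some x else none

/-- The map returned by `RetrieveValues(S)`. -/
def retrieved {n N : ℕ} (x : Fin n → Fin N) (S : Finset (Fin n)) : Fin n → Option (Fin N) :=
  fun j => if j ∈ S then some (x j) else none

/-- Global state. Entries of a process are written only while it is correct. -/
structure State (n D lam : ℕ) where
  /-- processes corrupted so far -/
  corrupted : Finset (Fin n)
  /-- processes that invoked `Toss`, hence started both draws and Gather -/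
  started : Finset (Fin n)
  ticketDraw : RSDState n
  valueDraw : RSDState n
  /-- the common core of Gather, once it is fixed -/
  core : Option (Finset (Fin n))
  /-- the set delivered by Gather to each process -/
  gathered : Fin n → Option (Finset (Fin n))
  /-- input of each process to the bundled approximate agreement -/
  input : Fin n → Option (Fin n → ℝ)
  /-- weights returned to each process by the bundled approximate agreement -/
  weights : Fin n → Option (Fin n → ℝ)
  /-- result of `RetrieveValues` on the ticket draw at each process -/
  tickets : Fin n → Option (Fin n → Option (Fin (2 ^ lam)))
  /-- result of `RetrieveValues` on the value draw at each process -/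
  values : Fin n → Option (Fin n → Option (Fin D))
  /-- value returned by `Toss` at each process -/
  output : Fin n → Option (Fin D)

def State.init (n D lam : ℕ) : State n D lam where
  corrupted := ∅
  started := ∅
  ticketDraw := ⟨∅, ∅⟩
  valueDraw := ⟨∅, ∅⟩
  core := none
  gathered := fun _ => none
  input := fun _ => none
  weights := fun _ => none
  tickets := fun _ => none
  values := fun _ => none
  output := fun _ => none

/-- The function `GatherAccept(j)` at process `i`: both draws have notified `i` about `j`. -/
def State.Accepts {n D lam : ℕ} (σ : State n D lam) (i j : Fin n) : Prop :=
  (i, j) ∈ σ.ticketDraw.notified ∧ (i, j) ∈ σ.valueDraw.notified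

/-- `{ j | w_j > 0 }`. -/
def candidates {n : ℕ} (w : Fin n → ℝ) : Finset (Fin n) :=
  open Classical in Finset.univ.filter fun j => 0 < w j

/-- `w_j = 1` if `j ∈ S` and `w_j = 0` otherwise. -/
def indicator {n : ℕ} (S : Finset (Fin n)) : Fin n → ℝ := fun j => if j ∈ S then 1 else 0

/-- The last two lines of `Toss`: the value of the candidate with maximal calibrated ticket. -/
def Protocol.decide {n D lam : ℕ} (P : Protocol n D lam) (w : Fin n → ℝ)
    (tickets : Fin n → Option (Fin (2 ^ lam))) (values : Fin n → Option (Fin D)) :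
    Option (Fin D) :=
  values (P.argmax (candidates w) fun j =>
    P.calibrate (w j) * ((tickets j).elim (0 : ℝ) fun t => ((t : ℕ) : ℝ)))

/-! ### Events -/

/-- The events of an execution. -/
inductive Event (n : ℕ)
  /-- the adversary corrupts `i` -/
  | corrupt (i : Fin n)
  /-- `i` invokes `Toss` -/
  | start (i : Fin n)
  /-- `i` is notified that `j` has been assigned a ticket -/
  | ticketAssigned (i j : Fin n)
  /-- `i` is notified that `j` has been assigned a value -/
  | valueAssigned (i j : Fin n)
  /-- the common core of Gather becomes fixed -/
  | fixCore (C : Finset (Fin n))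
  /-- Gather delivers the set `S` to `i` -/
  | deliverSet (i : Fin n) (S : Finset (Fin n))
  /-- the bundled approximate agreement returns `w` to `i` -/
  | returnWeights (i : Fin n) (w : Fin n → ℝ)
  /-- `RetrieveValues` on the ticket draw returns at `i` -/
  | returnTickets (i : Fin n)
  /-- `RetrieveValues` on the value draw returns at `i` -/
  | returnValues (i : Fin n)

/-- The events that can occur in a state. -/
def Enabled {n D lam : ℕ} (P : Protocol n D lam) (σ : State n D lam) : Event n → Prop
  | .corrupt i => i ∉ σ.corrupted ∧ σ.corrupted.card < P.f
  | .start i => i ∉ σ.corrupted ∧ i ∉ σ.started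
  | .ticketAssigned i _ => i ∉ σ.corrupted ∧ i ∈ σ.started
  | .valueAssigned i _ => i ∉ σ.corrupted ∧ i ∈ σ.started
  | .fixCore C => σ.core = none ∧ n - P.f ≤ C.card
  -- the common core has been fixed and is contained in every delivered set
  | .deliverSet i S => i ∉ σ.corrupted ∧ i ∈ σ.started ∧ σ.gathered i = none ∧
      (∀ j ∈ S, σ.Accepts i j) ∧ ∃ C, σ.core = some C ∧ C ⊆ S
  -- validity and approximate consistency, in each of the `n` coordinates
  | .returnWeights i w => i ∉ σ.corrupted ∧ σ.input i ≠ none ∧ σ.weights i = none ∧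
      (∀ j, ∃ a b x y, a ∉ σ.corrupted ∧ b ∉ σ.corrupted ∧ σ.input a = some x ∧
        σ.input b = some y ∧ x j ≤ w j ∧ w j ≤ y j) ∧
      (∀ k w', σ.weights k = some w' → ∀ j, |w j - w' j| ≤ P.eps)
  | .returnTickets i => i ∉ σ.corrupted ∧ σ.tickets i = none ∧
      ∃ w, σ.weights i = some w ∧ ∀ j ∈ candidates w, (i, j) ∈ σ.ticketDraw.notified
  | .returnValues i => i ∉ σ.corrupted ∧ σ.tickets i ≠ none ∧ σ.values i = none ∧
      ∃ w, σ.weights i = some w ∧ ∀ j ∈ candidates w, (i, j) ∈ σ.valueDraw.notified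

/-- The effect of an event, including the code that the process executes upon it. -/
def apply {n D lam : ℕ} (P : Protocol n D lam) (ω : Secrets n D lam) (σ : State n D lam) :
    Event n → State n D lam
  | .corrupt i => { σ with corrupted := insert i σ.corrupted }
  | .start i => { σ with started := insert i σ.started }
  | .ticketAssigned i j =>
      { σ with ticketDraw :=
          { σ.ticketDraw with notified := insert (i, j) σ.ticketDraw.notified } }
  | .valueAssigned i j =>
      { σ with valueDraw :=
          { σ.valueDraw with notified := insert (i, j) σ.valueDraw.notified } }
  | .fixCore C => { σ with core := some C }
  -- upon delivery the process invokes the approximate agreement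
  | .deliverSet i S =>
      { σ with
        gathered := Function.update σ.gathered i (some S)
        input := Function.update σ.input i (some (indicator S)) }
  -- upon completion of the approximate agreement the process enables retrieval in both draws
  | .returnWeights i w =>
      { σ with
        weights := Function.update σ.weights i (some w)
        ticketDraw := { σ.ticketDraw with enabled := insert i σ.ticketDraw.enabled }
        valueDraw := { σ.valueDraw with enabled := insert i σ.valueDraw.enabled } }
  | .returnTickets i =>
      { σ with
        tickets := Function.update σ.tickets i
          ((σ.weights i).map fun w => retrieved ω.1 (candidates w)) }
  -- the process now knows the tickets and the values of its candidates, and decides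
  | .returnValues i =>
      { σ with
        values := Function.update σ.values i
          ((σ.weights i).map fun w => retrieved ω.2 (candidates w))
        output := Function.update σ.output i
          ((σ.weights i).bind fun w => (σ.tickets i).bind fun t =>
            P.decide w t (retrieved ω.2 (candidates w))) }

/-- One step; an event that cannot occur is ignored. -/
def step {n D lam : ℕ} (P : Protocol n D lam) (ω : Secrets n D lam) (σ : State n D lam)
    (e : Event n) : State n D lam :=
  open Classical in if Enabled P σ e then apply P ω σ e else σ

/-! ### Adversaries and executions -/

/-- A (deterministic) adversary schedules the next event, given the events so far (most recent
first) and what has leaked of the tickets and of the values. -/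
abbrev Adversary (n D lam : ℕ) : Type :=
  List (Event n) → Option (Fin n → Fin (2 ^ lam)) → Option (Fin n → Fin D) → Event n

/-- Events and state after `k` steps. -/
def history {n D lam : ℕ} (P : Protocol n D lam) (A : Adversary n D lam)
    (ω : Secrets n D lam) : ℕ → List (Event n) × State n D lam
  | 0 => ([], State.init n D lam)
  | k + 1 =>
      let h := history P A ω k
      let e := A h.1 (h.2.ticketDraw.leak ω.1) (h.2.valueDraw.leak ω.2)
      (e :: h.1, step P ω h.2 e)

/-- The execution: the state after `k` steps. -/
def run {n D lam : ℕ} (P : Protocol n D lam) (A : Adversary n D lam) (ω : Secrets n D lam)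
    (k : ℕ) : State n D lam :=
  (history P A ω k).2

/-- The correct processes of an execution: those that are never corrupted. -/
def Correct {n D lam : ℕ} (tr : ℕ → State n D lam) : Set (Fin n) :=
  {i | ∀ k, i ∉ (tr k).corrupted}

/-- `p` is the first process to return (while correct) from the approximate agreement. -/
def FirstToComplete {n D lam : ℕ} (tr : ℕ → State n D lam) (p : Fin n) : Prop :=
  ∃ k, (∀ i, (tr k).weights i = none) ∧ (tr (k + 1)).weights p ≠ none

/-- Process `i` outputs `v`. -/
def Outputs {n D lam : ℕ} (tr : ℕ → State n D lam) (i : Fin n) (v : Fin D) : Prop :=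
  ∃ k, (tr k).output i = some v

/-! ### Liveness of the objects -/

inductive Component
  | rsd | gather | baa | retrieve

/-- Liveness of the objects. `within c k m` says that a reply at step `m` of component `c` to a
situation reached at step `k` is in time. -/
structure Live {n D lam : ℕ} (tr : ℕ → State n D lam) (within : Component → ℕ → ℕ → Prop) :
    Prop where
  /-- Random Secret Draw, assignment termination (tickets) -/
  ticket_assigned : ∀ k, (∀ i ∈ Correct tr, i ∈ (tr k).started) →
    ∀ i ∈ Correct tr, ∀ j ∈ Correct tr,
      ∃ m, within .rsd k m ∧ (i, j) ∈ (tr m).ticketDraw.notified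
  /-- Random Secret Draw, notification totality (tickets) -/
  ticket_totality : ∀ k, (∀ i ∈ Correct tr, i ∈ (tr k).started) →
    ∀ a j, (a, j) ∈ (tr k).ticketDraw.notified → ∀ i ∈ Correct tr,
      ∃ m, within .rsd k m ∧ (i, j) ∈ (tr m).ticketDraw.notified
  /-- Random Secret Draw, assignment termination (values) -/
  value_assigned : ∀ k, (∀ i ∈ Correct tr, i ∈ (tr k).started) →
    ∀ i ∈ Correct tr, ∀ j ∈ Correct tr,
      ∃ m, within .rsd k m ∧ (i, j) ∈ (tr m).valueDraw.notified
  /-- Random Secret Draw, notification totality (values) -/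
  value_totality : ∀ k, (∀ i ∈ Correct tr, i ∈ (tr k).started) →
    ∀ a j, (a, j) ∈ (tr k).valueDraw.notified → ∀ i ∈ Correct tr,
      ∃ m, within .rsd k m ∧ (i, j) ∈ (tr m).valueDraw.notified
  /-- Gather terminates if all correct processes participate and `GatherAccept` satisfies accept
  validity and accept totality -/
  gather : ∀ k, (∀ i ∈ Correct tr, i ∈ (tr k).started) →
    (∀ i ∈ Correct tr, ∀ j ∈ Correct tr, (tr k).Accepts i j) →
    (∀ l, k ≤ l → ∀ a j, (tr l).Accepts a j → ∀ i ∈ Correct tr,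
      ∃ m, within .rsd l m ∧ (tr m).Accepts i j) →
    ∀ i ∈ Correct tr, ∃ m, within .gather k m ∧ (tr m).gathered i ≠ none
  /-- the approximate agreement terminates if all correct processes participate -/
  baa : ∀ k, (∀ i ∈ Correct tr, (tr k).input i ≠ none) →
    ∀ i ∈ Correct tr, ∃ m, within .baa k m ∧ (tr m).weights i ≠ none
  /-- Random Secret Draw, reveal termination (tickets): `RetrieveValues`, invoked on the set of
  candidates, returns if all correct processes enabled retrieval and all candidates have been
  assigned a ticket -/
  tickets : ∀ k, (∀ i ∈ Correct tr, i ∈ (tr k).ticketDraw.enabled) →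
    ∀ i ∈ Correct tr, ∀ w, (tr k).weights i = some w →
      (∀ j ∈ candidates w, (i, j) ∈ (tr k).ticketDraw.notified) →
      ∃ m, within .retrieve k m ∧ (tr m).tickets i ≠ none
  /-- Random Secret Draw, reveal termination (values), invoked after the retrieval of tickets -/
  values : ∀ k, (∀ i ∈ Correct tr, i ∈ (tr k).valueDraw.enabled) →
    ∀ i ∈ Correct tr, ∀ w, (tr k).weights i = some w → (tr k).tickets i ≠ none →
      (∀ j ∈ candidates w, (i, j) ∈ (tr k).valueDraw.notified) →
      ∃ m, within .retrieve k m ∧ (tr m).values i ≠ none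

/-- A reply that comes eventually. -/
def eventually : Component → ℕ → ℕ → Prop := fun _ k m => k ≤ m

/-- All correct processes invoke `Toss`, and all objects eventually reply. -/
def Fair {n D lam : ℕ} (tr : ℕ → State n D lam) : Prop :=
  (∃ k, ∀ i ∈ Correct tr, i ∈ (tr k).started) ∧ Live tr eventually

/-! ### Probability -/

/-- A randomized adversary draws a seed from `ρ`; the secrets are uniform and independent of it. -/
def law {n D lam : ℕ} [NeZero D] {Seed : Type} (ρ : PMF Seed) : PMF (Seed × Secrets n D lam) :=
  ρ.bind fun s => (PMF.uniformOfFintype (Secrets n D lam)).map fun ω => (s, ω)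

/-- Probability of an event, when the adversary draws its seed from `ρ`. -/
def prob {n D lam : ℕ} [NeZero D] {Seed : Type} (ρ : PMF Seed)
    (E : Seed → Secrets n D lam → Prop) : ℝ :=
  ((law ρ).toOuterMeasure {x | E x.1 x.2}).toReal

/-- The protocol implements a common coin over the domain `Fin D` whose success probability is at
least `δ`, up to a loss. -/
structure IsCommonCoin {n D lam : ℕ} [NeZero D] (P : Protocol n D lam) (δ loss : ℝ) : Prop where
  /-- Termination: in every fair execution every correct process outputs a value. -/
  termination : ∀ (A : Adversary n D lam) (ω : Secrets n D lam), Fair (run P A ω) →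
    ∀ i ∈ Correct (run P A ω), ∃ v, Outputs (run P A ω) i v
  /-- Probabilistic consistency: with probability at least `δ - loss` no two correct processes
  output different values. -/
  consistency : ∀ (Seed : Type) (ρ : PMF Seed) (A : Seed → Adversary n D lam),
    δ - loss ≤ prob ρ fun s ω =>
      ∀ i ∈ Correct (run P (A s) ω), ∀ j ∈ Correct (run P (A s) ω), ∀ u v,
        Outputs (run P (A s) ω) i u → Outputs (run P (A s) ω) j v → u = v
  /-- Randomness: the coin has a value, exactly uniform over the domain whatever the seed of the
  adversary, which is the output of the process that is first to complete the approximate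
  agreement, and which, with probability at least `δ - loss`, is the output of all processes.
  Consequently, the output of every correct process is uniform up to a bias of
  `1 - δ + loss`. -/
  randomness : ∀ (Seed : Type) (ρ : PMF Seed) (A : Seed → Adversary n D lam),
    ∃ coin : Seed → Secrets n D lam → Fin D,
      (∀ s v, prob (PMF.pure s) (fun s ω => coin s ω = v) = 1 / (D : ℝ)) ∧
      (∀ v, prob ρ (fun s ω => coin s ω = v) = 1 / (D : ℝ)) ∧
      (∀ s ω p v, FirstToComplete (run P (A s) ω) p → Outputs (run P (A s) ω) p v →
        v = coin s ω) ∧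
      δ - loss ≤ prob ρ (fun s ω => ∀ i v, Outputs (run P (A s) ω) i v → v = coin s ω) ∧
      ((∀ s ω, Fair (run P (A s) ω)) → ∀ i, (∀ s ω, i ∈ Correct (run P (A s) ω)) →
        ∀ v, |prob ρ (fun s ω => Outputs (run P (A s) ω) i v) - 1 / (D : ℝ)| ≤ 1 - δ + loss)

/-! ### Complexity -/

/-- Constants of the implementations of the objects: communication per process, in the units
used in `communication`, and latency, in message delays. -/
structure Costs where
  rsdBits : ℕ
  gatherBits : ℕ
  baaBits : ℕ
  retrieveBits : ℕ
  rsdLatency : ℕ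
  gatherLatency : ℕ
  /-- message delays per round of approximate agreement -/
  baaLatency : ℕ
  retrieveLatency : ℕ

/-- Bits sent by a process when `n` numbers from a domain of size `N` are shared or retrieved,
up to a constant factor. -/
def shareBits (n lam N : ℕ) : ℕ := n * Nat.clog 2 N + n ^ 2 * lam

/-- Total number of bits sent by processes while correct: every process pays for each operation
that it invoked (two draws and Gather; all rounds of the approximate agreement; the retrieval of
tickets and of values). -/
def communication {n D lam : ℕ} (c : Costs) (P : Protocol n D lam) (σ : State n D lam) : ℕ :=
  open Classical in
  ∑ i : Fin n,
    ((if i ∈ σ.started then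
        c.rsdBits * shareBits n lam (2 ^ lam) + c.rsdBits * shareBits n lam D
          + c.gatherBits * (n ^ 2 * lam) else 0)
      + (if σ.input i ≠ none then P.rounds * (c.baaBits * (n ^ 2 * lam)) else 0)
      + (if i ∈ σ.ticketDraw.enabled then c.retrieveBits * shareBits n lam (2 ^ lam) else 0)
      + (if i ∈ σ.valueDraw.enabled then c.retrieveBits * shareBits n lam D else 0))

/-- Latency of the objects, in message delays. -/
def latency {n D lam : ℕ} (c : Costs) (P : Protocol n D lam) : Component → ℕ
  | .rsd => c.rsdLatency
  | .gather => c.gatherLatency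
  | .baa => c.baaLatency * P.rounds
  | .retrieve => c.retrieveLatency

/-- A reply within the latency of the object, when step `k` happens at time `τ k`. -/
def timely {n D lam : ℕ} (c : Costs) (P : Protocol n D lam) (τ : ℕ → ℝ) :
    Component → ℕ → ℕ → Prop :=
  fun x k m => k ≤ m ∧ τ m ≤ τ k + latency c P x

/-- In every execution whose objects respect their latencies, every correct process outputs a
value at most `T` message delays after all correct processes have invoked `Toss`. -/
def TimeBound {n D lam : ℕ} (c : Costs) (P : Protocol n D lam) (T : ℝ) : Prop :=
  ∀ (A : Adversary n D lam) (ω : Secrets n D lam) (τ : ℕ → ℝ), Monotone τ →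
    Live (run P A ω) (timely c P τ) →
    ∀ k, (∀ i ∈ Correct (run P A ω), i ∈ (run P A ω k).started) →
      ∀ i ∈ Correct (run P A ω), ∃ m v, τ m ≤ τ k + T ∧ (run P A ω m).output i = some v

/-- In every execution at most `B` bits are sent. -/
def CommunicationBound {n D lam : ℕ} (c : Costs) (P : Protocol n D lam) (B : ℝ) : Prop :=
  ∀ (A : Adversary n D lam) (ω : Secrets n D lam) (k : ℕ),
    (communication c P (run P A ω k) : ℝ) ≤ B

/-! ### The two instances of the algorithm -/

/-- `0` at `0`, and on `w > 0` the affine function with value `v` at `ε` and `1` at `1`. -/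
def calibration (ε v w : ℝ) : ℝ :=
  open Classical in
  if w = 0 then 0 else (w - ε) / (1 - ε) + (1 - w) / (1 - ε) * v

/-- `5 + ⌈log₂ (1/(1-δ)) + log₂ log₂ (1/(1-δ))⌉`, and at least `4`. -/
def calibratedRounds (δ : ℝ) : ℕ :=
  max 4 (5 + ⌈Real.logb 2 (1 / (1 - δ)) + Real.logb 2 (Real.logb 2 (1 / (1 - δ)))⌉).toNat

/-- The algorithm with weight calibration; calibration is used when
`n > (3/2) ln (2/(1-δ))`, with `v = 1 - ln (2/(1-δ)) / (2n/3)`. -/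
def calibrated (n D lam f : ℕ) (am : Finset (Fin n) → (Fin n → ℝ) → Fin n) (δ : ℝ) :
    Protocol n D lam where
  f := f
  rounds := calibratedRounds δ
  calibrate := open Classical in
    if 3 * Real.log (2 / (1 - δ)) / 2 < n then
      calibration ((2 : ℝ) ^ calibratedRounds δ)⁻¹ (1 - Real.log (2 / (1 - δ)) / (2 * n / 3))
    else id
  argmax := am

/-- The algorithm without calibration, with `3 + ⌈log₂ n + log₂ (1/(1-δ))⌉` rounds. -/
def uncalibrated (n D lam f : ℕ) (am : Finset (Fin n) → (Fin n → ℝ) → Fin n) (δ : ℝ) :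
    Protocol n D lam where
  f := f
  rounds := 3 + ⌈Real.logb 2 n + Real.logb 2 (1 / (1 - δ))⌉₊
  calibrate := id
  argmax := am

end MonteCarloCoin

end

open scoped ENNReal

namespace MonteCarloCoin

variable {n D lam : ℕ}

/-! ### Invariants of executions -/

/-! Everything is decided by the first process that completes the approximate agreement. Fix the
seed of the adversary. Until that completion nothing has leaked, and no step of the execution reads
the secrets, so the moment of the completion, the core `C` and the first returned weights `w₀` do
not depend on the secrets (`history_congr`, `history_succ_congr`). The process selected by `w₀` is
then a function of the tickets alone, and its value is exactly uniform because values are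
independent of tickets (`exists_holder`, `freq_value_eq`). This value is the coin. All weights
returned later equal 1 on `C`, lie in [0,1] and are within ε of `w₀`. It remains to bound the
fraction of tickets for which some such weights select another process (`Protocol.Stable`). A change
of selection forces the two largest products of `w₀` to be within 2εN, N being the number of
tickets. For a fixed winner `j` and fixed other tickets, this confines the ticket of `j` to an
interval of length 2εN/c, where c is the coefficient of `j`. If `j` is outside the core, c may be
small; but `j` beats the core, so cN is at least the maximum y of three core tickets. As y/N has
density about 3u², averaging 2εN/y gives about 3ε (`card_ambiguousAt_of_three`), and the union bound
over winners gives 3nε, plus rounding terms of order n/N. Without calibration one therefore takes ε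
of order (1-δ)/n. Calibration maps positive weights affinely with slope (1-v)/(1-ε), where 1-v is of
order L/n and L = ln(2/(1-δ)). The perturbation shrinks by this factor, and the total becomes of
order Lε, free of n. The price is a jump at 0: a process of weight at most ε may be a candidate for
some processes only. Its calibrated product is at most v(N-1), so it can win only if every core
ticket is that small, which has probability about v^(n-f) ≤ (1-δ)/2 (`stable_of_calibration`,
`stable_calibrated`). Termination and latency follow from one chain of six phases
(`exists_output_of_live`), read with two notions of a timely reply. The communication bound is a sum
of the costs per process. -/

lemma mem_candidates {w : Fin n → ℝ} {j : Fin n} : j ∈ candidates w ↔ 0 < w j := by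
  simp [candidates]

lemma indicator_nonneg (S : Finset (Fin n)) (j : Fin n) : 0 ≤ indicator S j := by
  unfold indicator; split_ifs <;> norm_num

lemma indicator_le_one (S : Finset (Fin n)) (j : Fin n) : indicator S j ≤ 1 := by
  unfold indicator; split_ifs <;> norm_num

lemma indicator_of_mem {S : Finset (Fin n)} {j : Fin n} (h : j ∈ S) : indicator S j = 1 :=
  if_pos h

lemma mem_of_indicator_pos {S : Finset (Fin n)} {j : Fin n} (h : 0 < indicator S j) : j ∈ S := by
  by_contra hj
  simp [indicator, hj] at h

lemma Protocol.eps_pos (P : Protocol n D lam) : 0 < P.eps := by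
  unfold Protocol.eps; positivity

/-- The value that a process with weights `w` outputs. -/
noncomputable def Protocol.outcome (P : Protocol n D lam) (ω : Secrets n D lam) (w : Fin n → ℝ) :
    Option (Fin D) :=
  P.decide w (retrieved ω.1 (candidates w)) (retrieved ω.2 (candidates w))

/-- The weights that are compatible with the common core `C`. -/
def Admissible (C : Finset (Fin n)) (w : Fin n → ℝ) : Prop :=
  (∀ j ∈ C, w j = 1) ∧ ∀ j, 0 ≤ w j ∧ w j ≤ 1

/-- Properties of all reachable states. -/
structure Reachable (P : Protocol n D lam) (ω : Secrets n D lam) (σ : State n D lam) : Prop where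
  core : ∀ C, σ.core = some C → n - P.f ≤ C.card
  input : ∀ i x, σ.input i = some x → ∃ S C, x = indicator S ∧ σ.core = some C ∧ C ⊆ S ∧
    ∀ j ∈ S, σ.Accepts i j
  gathered : ∀ i, σ.gathered i ≠ none → σ.input i ≠ none
  weights : ∀ i w, σ.weights i = some w → ∃ C, σ.core = some C ∧ Admissible C w ∧
    ∀ j, 0 < w j → ∃ a, σ.Accepts a j
  close : ∀ i k w w', σ.weights i = some w → σ.weights k = some w' → ∀ j, |w j - w' j| ≤ P.eps
  ticket_enabled : ∀ i, i ∈ σ.ticketDraw.enabled ↔ σ.weights i ≠ none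
  value_enabled : ∀ i, i ∈ σ.valueDraw.enabled ↔ σ.weights i ≠ none
  tickets : ∀ i t, σ.tickets i = some t → ∃ w, σ.weights i = some w ∧
    t = retrieved ω.1 (candidates w)
  output : ∀ i, (σ.values i = none ∧ σ.output i = none) ∨
    ∃ w, σ.weights i = some w ∧ σ.output i = P.outcome ω w

lemma Reachable.init (P : Protocol n D lam) (ω : Secrets n D lam) :
    Reachable P ω (State.init n D lam) := by
  constructor <;> simp [State.init]

/-- Admissibility of weights in the range of the inputs of correct processes. -/
lemma Reachable.admissible_of_range {P : Protocol n D lam} {ω : Secrets n D lam}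
    {σ : State n D lam} (h : Reachable P ω σ) (hn : 0 < n) {w : Fin n → ℝ}
    (hw : ∀ j, ∃ a b x y, a ∉ σ.corrupted ∧ b ∉ σ.corrupted ∧ σ.input a = some x ∧
        σ.input b = some y ∧ x j ≤ w j ∧ w j ≤ y j) :
    ∃ C, σ.core = some C ∧ Admissible C w ∧ ∀ j, 0 < w j → ∃ a, σ.Accepts a j := by
  obtain ⟨a, b, x, y, -, -, hx, -⟩ := hw ⟨0, hn⟩
  obtain ⟨S, C, -, hC, -⟩ := h.input a x hx
  refine ⟨C, hC, ⟨fun j hj => ?_, fun j => ?_⟩, fun j hj => ?_⟩ <;>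
  obtain ⟨a, b, x, y, -, -, hx, hy, hxw, hwy⟩ := hw j <;>
  obtain ⟨S, C₁, rfl, hC₁, hS, hSa⟩ := h.input a x hx <;>
  obtain ⟨S', C₂, rfl, hC₂, hS', hSa'⟩ := h.input b y hy <;>
  obtain rfl : C = C₁ := Option.some.inj (hC.symm.trans hC₁) <;>
  obtain rfl : C = C₂ := Option.some.inj (hC.symm.trans hC₂)
  · rw [indicator_of_mem (hS hj)] at hxw
    rw [indicator_of_mem (hS' hj)] at hwy
    exact le_antisymm hwy hxw
  · exact ⟨(indicator_nonneg _ _).trans hxw, hwy.trans (indicator_le_one _ _)⟩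
  · exact ⟨b, hSa' j (mem_of_indicator_pos (hj.trans_le hwy))⟩

/-- What only grows along an execution. -/
structure Extends (σ σ' : State n D lam) : Prop where
  started : σ.started ⊆ σ'.started
  ticket_notified : σ.ticketDraw.notified ⊆ σ'.ticketDraw.notified
  value_notified : σ.valueDraw.notified ⊆ σ'.valueDraw.notified
  core : ∀ C, σ.core = some C → σ'.core = some C
  gathered : ∀ i, σ.gathered i ≠ none → σ'.gathered i ≠ none
  input : ∀ i, σ.input i ≠ none → σ'.input i ≠ none
  weights : ∀ i w, σ.weights i = some w → σ'.weights i = some w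
  tickets : ∀ i, σ.tickets i ≠ none → σ'.tickets i ≠ none
  values : ∀ i, σ.values i ≠ none → σ'.values i ≠ none

lemma Extends.refl (σ : State n D lam) : Extends σ σ := by
  constructor <;> intros <;> first | rfl | assumption

lemma Extends.trans {σ₁ σ₂ σ₃ : State n D lam} (h : Extends σ₁ σ₂) (h' : Extends σ₂ σ₃) :
    Extends σ₁ σ₃ where
  started := h.started.trans h'.started
  ticket_notified := h.ticket_notified.trans h'.ticket_notified
  value_notified := h.value_notified.trans h'.value_notified
  core C hC := h'.core C (h.core C hC)
  gathered i hi := h'.gathered i (h.gathered i hi)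
  input i hi := h'.input i (h.input i hi)
  weights i w hw := h'.weights i w (h.weights i w hw)
  tickets i hi := h'.tickets i (h.tickets i hi)
  values i hi := h'.values i (h.values i hi)

lemma Extends.accepts {σ σ' : State n D lam} (h : Extends σ σ') {i j : Fin n}
    (hij : σ.Accepts i j) : σ'.Accepts i j :=
  ⟨h.ticket_notified hij.1, h.value_notified hij.2⟩

/-- The guards in `Enabled` let the core and the weights be written only when empty, and a retrieval
never stores `none` because its guard provides weights. -/
lemma Reachable.extends_step {P : Protocol n D lam} {ω : Secrets n D lam} {σ : State n D lam}
    (h : Reachable P ω σ) (e : Event n) : Extends σ (step P ω σ e) := by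
  unfold step
  split_ifs with he
  swap
  · exact Extends.refl σ
  have hout := h.output
  cases e <;> simp only [Enabled] at he <;> constructor <;> simp only [apply] <;>
    grind [Function.update_apply]

/-- The new content enters at `returnWeights`, where the range of the inputs yields admissibility,
and at `returnValues`, where the stored tickets are recognized as those of the current weights.
Stored tickets and outputs stay tied to the weights because weights are written once. -/
lemma Reachable.step {P : Protocol n D lam} {ω : Secrets n D lam} {σ : State n D lam}
    (hn : 0 < n) (h : Reachable P ω σ) (e : Event n) : Reachable P ω (step P ω σ e) := by
  unfold MonteCarloCoin.step
  split_ifs with he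
  swap
  · exact h
  have heps := P.eps_pos
  obtain ⟨h1, h2, h3, h4, h5, h6, h7, h8, h9⟩ := h
  cases e with
  | corrupt i => exact ⟨h1, h2, h3, h4, h5, h6, h7, h8, h9⟩
  | start i => exact ⟨h1, h2, h3, h4, h5, h6, h7, h8, h9⟩
  | ticketAssigned i j =>
    refine ⟨h1, fun i x hx => ?_, h3, fun i w hw => ?_, h5, h6, h7, h8, h9⟩
    · obtain ⟨S, C, hS, hC, hCS, hacc⟩ := h2 i x hx
      exact ⟨S, C, hS, hC, hCS, fun j hj =>
        ⟨Finset.mem_insert_of_mem (hacc j hj).1, (hacc j hj).2⟩⟩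
    · obtain ⟨C, hC, hw, hacc⟩ := h4 i w hw
      refine ⟨C, hC, hw, fun j hj => ?_⟩
      obtain ⟨a, ha⟩ := hacc j hj
      exact ⟨a, Finset.mem_insert_of_mem ha.1, ha.2⟩
  | valueAssigned i j =>
    refine ⟨h1, fun i x hx => ?_, h3, fun i w hw => ?_, h5, h6, h7, h8, h9⟩
    · obtain ⟨S, C, hS, hC, hCS, hacc⟩ := h2 i x hx
      exact ⟨S, C, hS, hC, hCS, fun j hj =>
        ⟨(hacc j hj).1, Finset.mem_insert_of_mem (hacc j hj).2⟩⟩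
    · obtain ⟨C, hC, hw, hacc⟩ := h4 i w hw
      refine ⟨C, hC, hw, fun j hj => ?_⟩
      obtain ⟨a, ha⟩ := hacc j hj
      exact ⟨a, ha.1, Finset.mem_insert_of_mem ha.2⟩
  | fixCore C =>
    obtain ⟨hnone, hcard⟩ := he
    refine ⟨fun C' hC' => ?_, fun i x hx => ?_, h3, fun i w hw => ?_, h5, h6, h7, h8, h9⟩
    · obtain rfl : C = C' := Option.some.inj hC'
      exact hcard
    · obtain ⟨S, C, hS, hC, hCS, hacc⟩ := h2 i x hx
      simp [hnone] at hC
    · obtain ⟨C, hC, -⟩ := h4 i w hw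
      simp [hnone] at hC
  | deliverSet i S =>
    obtain ⟨-, -, -, hacc, C, hC, hCS⟩ := he
    refine ⟨h1, fun a x hx => ?_, fun a ha => ?_, h4, h5, h6, h7, h8, h9⟩
    · by_cases hai : a = i
      · subst hai
        refine ⟨S, C, ?_, hC, hCS, hacc⟩
        simpa [apply, eq_comm] using hx
      · exact h2 a x (by simpa [apply, hai] using hx)
    · by_cases hai : a = i
      · subst hai
        simp [apply]
      · have := h3 a (by simpa [apply, hai] using ha)
        simpa [apply, hai] using this
  | returnWeights i w =>
    obtain ⟨-, -, hnone, hrange, hclose⟩ := he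
    refine ⟨h1, h2, h3, fun a w' hw' => ?_, fun a b w₁ w₂ hw₁ hw₂ j => ?_, fun a => ?_,
      fun a => ?_, fun a t ht => ?_, fun a => ?_⟩
    · by_cases hai : a = i
      · subst hai
        obtain rfl : w = w' := by simpa [apply] using hw'
        exact Reachable.admissible_of_range ⟨h1, h2, h3, h4, h5, h6, h7, h8, h9⟩ hn hrange
      · exact h4 a w' (by simpa [apply, hai] using hw')
    · by_cases hai : a = i <;> by_cases hbi : b = i
      · subst hai; subst hbi
        simp only [apply, Function.update_self, Option.some.injEq] at hw₁ hw₂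
        subst hw₁; subst hw₂
        simpa using heps.le
      · subst hai
        simp only [apply, Function.update_self, Option.some.injEq] at hw₁
        subst hw₁
        exact hclose b w₂ (by simpa [apply, hbi] using hw₂) j
      · subst hbi
        simp only [apply, Function.update_self, Option.some.injEq] at hw₂
        subst hw₂
        rw [abs_sub_comm]
        exact hclose a w₁ (by simpa [apply, hai] using hw₁) j
      · exact h5 a b w₁ w₂ (by simpa [apply, hai] using hw₁) (by simpa [apply, hbi] using hw₂) j
    · by_cases hai : a = i
      · subst hai; simp [apply]
      · simpa [apply, hai] using h6 a
    · by_cases hai : a = i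
      · subst hai; simp [apply]
      · simpa [apply, hai] using h7 a
    · obtain ⟨w', hw', ht'⟩ := h8 a t ht
      have hai : a ≠ i := by rintro rfl; simp [hnone] at hw'
      exact ⟨w', by simpa [apply, hai] using hw', ht'⟩
    · rcases h9 a with h | ⟨w', hw', ho⟩
      · exact Or.inl h
      · have hai : a ≠ i := by rintro rfl; simp [hnone] at hw'
        exact Or.inr ⟨w', by simpa [apply, hai] using hw', ho⟩
  | returnTickets i =>
    obtain ⟨-, -, w, hw, -⟩ := he
    refine ⟨h1, h2, h3, h4, h5, h6, h7, fun a t ht => ?_, h9⟩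
    by_cases hai : a = i
    · subst hai
      refine ⟨w, hw, ?_⟩
      simpa [apply, hw, eq_comm] using ht
    · exact h8 a t (by simpa [apply, hai] using ht)
  | returnValues i =>
    obtain ⟨-, htick, -, w, hw, -⟩ := he
    refine ⟨h1, h2, h3, h4, h5, h6, h7, h8, fun a => ?_⟩
    by_cases hai : a = i
    · subst hai
      refine Or.inr ⟨w, hw, ?_⟩
      obtain ⟨t, ht⟩ := Option.ne_none_iff_exists'.1 htick
      obtain ⟨w', hw', rfl⟩ := h8 a t ht
      obtain rfl : w = w' := Option.some.inj (hw.symm.trans hw')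
      simp [apply, hw, ht, Protocol.outcome]
    · simpa [apply, hai] using h9 a

/-! ### Executions. -/

lemma run_succ (P : Protocol n D lam) (A : Adversary n D lam) (ω : Secrets n D lam) (k : ℕ) :
    run P A ω (k + 1) = step P ω (run P A ω k) (A (history P A ω k).1
      ((run P A ω k).ticketDraw.leak ω.1) ((run P A ω k).valueDraw.leak ω.2)) := rfl

lemma reachable_run (hn : 0 < n) (P : Protocol n D lam) (A : Adversary n D lam)
    (ω : Secrets n D lam) (k : ℕ) : Reachable P ω (run P A ω k) := by
  induction k with
  | zero => exact Reachable.init P ω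
  | succ k ih => rw [run_succ]; exact ih.step hn _

lemma extends_run (hn : 0 < n) (P : Protocol n D lam) (A : Adversary n D lam)
    (ω : Secrets n D lam) {k m : ℕ} (h : k ≤ m) : Extends (run P A ω k) (run P A ω m) := by
  induction m, h using Nat.le_induction with
  | base => exact Extends.refl _
  | succ m _ ih => rw [run_succ]; exact ih.trans ((reachable_run hn P A ω m).extends_step _)

/-- The output of a process is determined by its weights. -/
lemma Reachable.exists_weights_of_output {P : Protocol n D lam} {ω : Secrets n D lam}
    {σ : State n D lam} (h : Reachable P ω σ) {i : Fin n} {v : Fin D}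
    (hv : σ.output i = some v) : ∃ w, σ.weights i = some w ∧ P.outcome ω w = some v := by
  rcases h.output i with ⟨-, h'⟩ | ⟨w, hw, ho⟩
  · simp [hv] at h'
  · exact ⟨w, hw, ho ▸ hv⟩

/-- The process selected by a process with weights `w`. -/
noncomputable def Protocol.select (P : Protocol n D lam) (T : Fin n → Fin (2 ^ lam)) (w : Fin n → ℝ) : Fin n :=
  P.argmax (candidates w) fun j => P.calibrate (w j) *
    ((retrieved T (candidates w) j).elim (0 : ℝ) fun t => ((t : ℕ) : ℝ))

lemma Admissible.candidates_nonempty {C : Finset (Fin n)} {w : Fin n → ℝ} (h : Admissible C w)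
    (hC : C.Nonempty) : (candidates w).Nonempty := by
  obtain ⟨j, hj⟩ := hC
  exact ⟨j, mem_candidates.2 (by rw [h.1 j hj]; norm_num)⟩

lemma Protocol.outcome_eq {P : Protocol n D lam} (ham : IsArgmax P.argmax)
    (ω : Secrets n D lam) {w : Fin n → ℝ} (hw : (candidates w).Nonempty) :
    P.outcome ω w = some (ω.2 (P.select ω.1 w)) := by
  have := (ham _ (fun j => P.calibrate (w j) *
    ((retrieved ω.1 (candidates w) j).elim (0 : ℝ) fun t => ((t : ℕ) : ℝ))) hw).1
  unfold Protocol.outcome Protocol.decide Protocol.select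
  rw [retrieved, if_pos this]

lemma Protocol.select_mem {P : Protocol n D lam} (ham : IsArgmax P.argmax)
    (T : Fin n → Fin (2 ^ lam)) {w : Fin n → ℝ} (hw : (candidates w).Nonempty) :
    0 < w (P.select T w) :=
  mem_candidates.1 (ham _ _ hw).1

/-- The default ticket 0 in `decide` plays no role: all competitors are candidates, and their
tickets have been retrieved. -/
lemma Protocol.le_select {P : Protocol n D lam} (ham : IsArgmax P.argmax)
    (T : Fin n → Fin (2 ^ lam)) {w : Fin n → ℝ} {j : Fin n} (hj : 0 < w j) :
    P.calibrate (w j) * (T j : ℕ) ≤ P.calibrate (w (P.select T w)) * (T (P.select T w) : ℕ) := by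
  have hj' := mem_candidates.2 hj
  have h := ham (candidates w) (fun j => P.calibrate (w j) *
    ((retrieved T (candidates w) j).elim (0 : ℝ) fun t => ((t : ℕ) : ℝ))) ⟨j, hj'⟩
  have h2 := h.2 j hj'
  have h1 : P.select T w ∈ candidates w := h.1
  change _ ≤ P.calibrate (w (P.select T w)) *
    ((retrieved T (candidates w) (P.select T w)).elim (0 : ℝ) fun t => ((t : ℕ) : ℝ)) at h2
  simpa [retrieved, hj', h1] using h2

/-! ### Termination -/

/-- The properties of `within` used for termination. -/
structure IsDeadline (within : Component → ℕ → ℕ → Prop) : Prop where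
  refl : ∀ c k, within c k k
  le : ∀ c k m, within c k m → k ≤ m
  sup : ∀ c k m m', within c k m → within c k m' → within c k (max m m')

lemma isDeadline_eventually : IsDeadline eventually where
  refl _ k := le_refl k
  le _ _ _ h := h
  sup _ _ _ _ h _ := le_max_of_le_left h

lemma isDeadline_timely (c : Costs) (P : Protocol n D lam) (τ : ℕ → ℝ) :
    IsDeadline (timely c P τ) where
  refl x k := ⟨le_refl k, by simp⟩
  le _ _ _ h := h.1
  sup x k m m' h h' := by
    rcases max_choice m m' with e | e <;> rw [e] <;> assumption

/-- Finitely many replies of a component that are in time are simultaneously in time. -/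
lemma IsDeadline.collect {within : Component → ℕ → ℕ → Prop} (hW : IsDeadline within)
    {ι : Type*} [Finite ι] (c : Component) (k : ℕ) (Q : ι → ℕ → Prop)
    (hmono : ∀ i m m', m ≤ m' → Q i m → Q i m') (h : ∀ i, ∃ m, within c k m ∧ Q i m) :
    ∃ m, within c k m ∧ ∀ i, Q i m := by
  have := Fintype.ofFinite ι
  suffices H : ∀ s : Finset ι, ∃ m, within c k m ∧ ∀ i ∈ s, Q i m by
    obtain ⟨m, hm, hs⟩ := H Finset.univ
    exact ⟨m, hm, fun i => hs i (Finset.mem_univ i)⟩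
  classical
  intro s
  induction s using Finset.induction_on with
  | empty => exact ⟨k, hW.refl c k, by simp⟩
  | insert a s _ ih =>
    obtain ⟨m, hm, hs⟩ := ih
    obtain ⟨m', hm', ha⟩ := h a
    refine ⟨max m m', hW.sup _ _ _ _ hm hm', fun i hi => ?_⟩
    rcases Finset.mem_insert.1 hi with rfl | hi
    · exact hmono _ _ _ (le_max_right _ _) ha
    · exact hmono _ _ _ (le_max_left _ _) (hs i hi)

/-- Once all correct processes have invoked `Toss`, they all output a value after a sequence of
six phases. -/
lemma exists_output_of_live {P : Protocol n D lam} {A : Adversary n D lam} {ω : Secrets n D lam}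
    {within : Component → ℕ → ℕ → Prop} (hW : IsDeadline within) (hf : 3 * P.f < n)
    (ham : IsArgmax P.argmax) (hlive : Live (run P A ω) within) {k : ℕ}
    (hstart : ∀ i ∈ Correct (run P A ω), i ∈ (run P A ω k).started) :
    ∃ k₁ k₂ k₃ k₄ k₅ k₆, within .rsd k k₁ ∧ within .gather k₁ k₂ ∧ within .baa k₂ k₃ ∧
      within .rsd k₃ k₄ ∧ within .retrieve k₄ k₅ ∧ within .retrieve k₅ k₆ ∧
      ∀ i ∈ Correct (run P A ω), ∃ v, (run P A ω k₆).output i = some v := by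
  have hn : 0 < n := by omega
  have hext : ∀ {a b : ℕ}, a ≤ b → Extends (run P A ω a) (run P A ω b) :=
    fun h => extends_run hn P A ω h
  set tr := run P A ω with htr
  have hreach : ∀ k, Reachable P ω (tr k) := reachable_run hn P A ω
  have hstarted : ∀ l, k ≤ l → ∀ i ∈ Correct tr, i ∈ (tr l).started :=
    fun l hl i hi => (hext hl).started (hstart i hi)
  have htotal : ∀ l, k ≤ l → ∀ a j, (tr l).Accepts a j → ∀ i ∈ Correct tr,
      ∃ m, within .rsd l m ∧ (tr m).Accepts i j := by
    intro l hl a j haj i hi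
    obtain ⟨m, hm, h⟩ := hlive.ticket_totality l (hstarted l hl) a j haj.1 i hi
    obtain ⟨m', hm', h'⟩ := hlive.value_totality l (hstarted l hl) a j haj.2 i hi
    exact ⟨max m m', hW.sup _ _ _ _ hm hm', (hext (le_max_left _ _)).ticket_notified h,
      (hext (le_max_right _ _)).value_notified h'⟩
  have hassigned : ∀ q : Correct tr × Correct tr,
      ∃ m, within .rsd k m ∧ (tr m).Accepts q.1 q.2 := by
    rintro ⟨⟨i, hi⟩, j, hj⟩
    obtain ⟨m, hm, h⟩ := hlive.ticket_assigned k hstart i hi j hj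
    obtain ⟨m', hm', h'⟩ := hlive.value_assigned k hstart i hi j hj
    exact ⟨max m m', hW.sup _ _ _ _ hm hm', (hext (le_max_left _ _)).ticket_notified h,
      (hext (le_max_right _ _)).value_notified h'⟩
  obtain ⟨k₁, hk₁, h₁⟩ := hW.collect .rsd k
    (fun (q : Correct tr × Correct tr) m => (tr m).Accepts q.1 q.2)
    (fun _ _ _ h => (hext h).accepts) hassigned
  have le₁ := hW.le _ _ _ hk₁
  obtain ⟨k₂, hk₂, h₂⟩ := hW.collect .gather k₁
    (fun (i : Correct tr) m => (tr m).gathered i ≠ none) (fun i _ _ h => (hext h).gathered i)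
    (fun i => hlive.gather k₁ (hstarted k₁ le₁) (fun i hi j hj => h₁ (⟨i, hi⟩, ⟨j, hj⟩))
      (fun l hl => htotal l (le₁.trans hl)) i i.2)
  have le₂ := hW.le _ _ _ hk₂
  obtain ⟨k₃, hk₃, h₃⟩ := hW.collect .baa k₂
    (fun (i : Correct tr) m => (tr m).weights i ≠ none)
    (fun i a b h hi => by
      obtain ⟨w, hw⟩ := Option.ne_none_iff_exists'.1 hi
      rw [(hext h).weights i w hw]
      simp)
    (fun i => hlive.baa k₂ (fun i hi => (hreach k₂).gathered i (h₂ ⟨i, hi⟩)) i i.2)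
  have le₃ := hW.le _ _ _ hk₃
  choose w hw using fun i => Option.ne_none_iff_exists'.1 (h₃ i)
  -- A candidate has positive weight, so it lies in some gathered set and was accepted by some
  -- process; totality spreads its notifications to all correct processes.
  obtain ⟨k₄, hk₄, h₄⟩ := hW.collect .rsd k₃
    (fun (q : (i : Correct tr) × {j // 0 < w i j}) m => (tr m).Accepts q.1 q.2)
    (fun _ _ _ h => (hext h).accepts)
    (fun q => by
      obtain ⟨C, -, -, hacc⟩ := (hreach k₃).weights q.1 (w q.1) (hw q.1)
      obtain ⟨a, ha⟩ := hacc q.2 q.2.2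
      exact htotal k₃ (le₁.trans (le₂.trans le₃)) a q.2 ha q.1 q.1.2)
  have le₄ := hW.le _ _ _ hk₄
  have hw' : ∀ m, k₃ ≤ m → ∀ i : Correct tr, (tr m).weights i = some (w i) :=
    fun m hm i => (hext hm).weights i _ (hw i)
  obtain ⟨k₅, hk₅, h₅⟩ := hW.collect .retrieve k₄
    (fun (i : Correct tr) m => (tr m).tickets i ≠ none) (fun i _ _ h => (hext h).tickets i)
    (fun i => hlive.tickets k₄
      (fun i hi => ((hreach k₄).ticket_enabled i).2 (by rw [hw' k₄ le₄ ⟨i, hi⟩]; simp))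
      i i.2 (w i) (hw' k₄ le₄ i) (fun j hj => (h₄ ⟨i, j, mem_candidates.1 hj⟩).1))
  have le₅ := hW.le _ _ _ hk₅
  obtain ⟨k₆, hk₆, h₆⟩ := hW.collect .retrieve k₅
    (fun (i : Correct tr) m => (tr m).values i ≠ none) (fun i _ _ h => (hext h).values i)
    (fun i => hlive.values k₅
      (fun i hi => ((hreach k₅).value_enabled i).2
        (by rw [hw' k₅ (le₄.trans le₅) ⟨i, hi⟩]; simp))
      i i.2 (w i) (hw' k₅ (le₄.trans le₅) i) (h₅ i)
      (fun j hj => (hext le₅).value_notified (h₄ ⟨i, j, mem_candidates.1 hj⟩).2))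
  refine ⟨k₁, k₂, k₃, k₄, k₅, k₆, hk₁, hk₂, hk₃, hk₄, hk₅, hk₆, fun i hi => ?_⟩
  rcases (hreach k₆).output i with ⟨hnone, -⟩ | ⟨w, hw, ho⟩
  · exact absurd hnone (h₆ ⟨i, hi⟩)
  · obtain ⟨C, hC, hadm, -⟩ := (hreach k₆).weights i w hw
    have hcard := (hreach k₆).core C hC
    have hne : C.Nonempty := Finset.card_pos.1 (by omega)
    exact ⟨_, ho.trans (P.outcome_eq ham ω (hadm.candidates_nonempty hne))⟩

/-! ### Counting ambiguous tickets -/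

section Counting

variable {N : ℕ}

/-- A set of integers of diameter at most `L` has at most `L + 1` elements. -/
lemma card_le_of_diam (S : Finset (Fin N)) {L : ℝ} (hL : 0 ≤ L)
    (h : ∀ x ∈ S, ∀ y ∈ S, ((y : ℕ) : ℝ) - ((x : ℕ) : ℝ) ≤ L) : (S.card : ℝ) ≤ L + 1 := by
  rcases S.eq_empty_or_nonempty with rfl | hS
  · simp; linarith
  set a := S.min' hS with ha
  have hsub : S.map Fin.valEmbedding ⊆ Finset.Icc (a : ℕ) (a + ⌊L⌋₊) := by
    intro m hm
    obtain ⟨x, hx, rfl⟩ := Finset.mem_map.1 hm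
    have h1 : a ≤ x := Finset.min'_le _ _ hx
    have h2 := h a (Finset.min'_mem _ _) x hx
    have h1' : (a : ℕ) ≤ x := h1
    have h3 : (x : ℕ) - (a : ℕ) ≤ ⌊L⌋₊ := Nat.le_floor (by rwa [Nat.cast_sub h1'])
    simp only [Fin.valEmbedding_apply, Finset.mem_Icc]
    omega
  have hc := Finset.card_le_card hsub
  rw [Finset.card_map, Nat.card_Icc] at hc
  have h4 : (S.card : ℝ) ≤ (⌊L⌋₊ : ℝ) + 1 := by
    have : S.card ≤ ⌊L⌋₊ + 1 := by omega
    exact_mod_cast this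
  linarith [Nat.floor_le hL]

/-- Counting along the `j`-th coordinate. -/
lemma card_mul_le_of_fiber (j : Fin n) (A B : Finset (Fin n → Fin N)) {q : ℝ}
    (hAB : ∀ T ∈ A, ∀ t, Function.update T j t ∈ B)
    (hq : ∀ T ∈ B, (((Finset.univ.filter fun t => Function.update T j t ∈ A).card : ℕ) : ℝ) ≤ q) :
    (A.card : ℝ) * N ≤ B.card * q := by
  have h1 : (A ×ˢ (Finset.univ : Finset (Fin N))).card ≤
      (B.sigma fun T => Finset.univ.filter fun t => Function.update T j t ∈ A).card := by
    -- Exchange `t` with the `j`-th coordinate of `T`. The pair is recovered by exchanging back, and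
    -- the modified tuple lies in `B`.
    refine Finset.card_le_card_of_injOn
      (fun x => ⟨Function.update x.1 j x.2, x.1 j⟩) ?_ ?_
    · rintro ⟨T, t⟩ hx
      have hT : T ∈ A := by simpa using hx
      simp [hAB T hT t, hT]
    · rintro ⟨T, t⟩ - ⟨T', t'⟩ - h
      simp only [Sigma.mk.injEq, heq_eq_eq] at h
      obtain ⟨h1, h2⟩ := h
      have h3 : t = t' := by simpa using congrFun h1 j
      refine Prod.ext (funext fun l => ?_) h3
      by_cases hl : l = j
      · subst hl; exact h2
      · simpa [hl] using congrFun h1 l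
  rw [Finset.card_product, Finset.card_sigma, Finset.card_univ, Fintype.card_fin] at h1
  have h2 : ((A.card * N : ℕ) : ℝ) ≤
      ((∑ T ∈ B, (Finset.univ.filter fun t => Function.update T j t ∈ A).card : ℕ) : ℝ) :=
    by exact_mod_cast h1
  push_cast at h2
  refine h2.trans ((Finset.sum_le_card_nsmul _ _ q fun T hT => hq T hT).trans ?_)
  rw [nsmul_eq_mul]

/-- A box of which only the sides in `C` are proper. -/
lemma card_box (C : Finset (Fin n)) (s : Fin n → Finset (Fin N))
    (hs : ∀ l ∉ C, s l = Finset.univ) :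
    ((Fintype.piFinset s).card : ℝ) * N ^ C.card = N ^ n * ∏ l ∈ C, ((s l).card : ℝ) := by
  rw [Fintype.card_piFinset, Nat.cast_prod, ← Finset.prod_mul_prod_compl C]
  have : ∏ l ∈ Cᶜ, ((s l).card : ℝ) = N ^ (n - C.card) := by
    rw [Finset.prod_congr rfl (g := fun _ => (N : ℝ)), Finset.prod_const, Finset.card_compl,
      Fintype.card_fin]
    intro l hl
    rw [hs l (Finset.mem_compl.1 hl), Finset.card_univ, Fintype.card_fin]
  have hle : C.card ≤ n := by simpa using Finset.card_le_univ C
  rw [this, mul_assoc, ← pow_add, Nat.sub_add_cancel hle, mul_comm]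

/-- The tickets for which `j` has maximal product with the coefficients `c`, but some other
process is within `2 * η * N`. -/
noncomputable def ambiguousAt (c : Fin n → ℝ) (η : ℝ) (N : ℕ) (j : Fin n) :
    Finset (Fin n → Fin N) :=
  open Classical in
  Finset.univ.filter fun T => (∀ l, c l * (T l : ℕ) ≤ c j * (T j : ℕ)) ∧
    ∃ k ≠ j, c j * (T j : ℕ) ≤ c k * (T k : ℕ) + 2 * η * N

lemma mem_ambiguousAt {c : Fin n → ℝ} {η : ℝ} {j : Fin n} {T : Fin n → Fin N} :
    T ∈ ambiguousAt c η N j ↔ (∀ l, c l * (T l : ℕ) ≤ c j * (T j : ℕ)) ∧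
      ∃ k ≠ j, c j * (T j : ℕ) ≤ c k * (T k : ℕ) + 2 * η * N := by
  simp [ambiguousAt]

/-- The rival `k` of the second tuple has the same ticket in the first tuple, where `j` beats it.
Hence both products of `j` lie within 2ηN above the product of `k`, up to order. -/
lemma diam_ambiguousAt {c : Fin n → ℝ} {η : ℝ} {j : Fin n} {T : Fin n → Fin N} {t t' : Fin N}
    (h : Function.update T j t ∈ ambiguousAt c η N j)
    (h' : Function.update T j t' ∈ ambiguousAt c η N j) :
    c j * (((t' : ℕ) : ℝ) - ((t : ℕ) : ℝ)) ≤ 2 * η * N := by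
  obtain ⟨k, hk, h2⟩ := (mem_ambiguousAt.1 h').2
  have h1 := (mem_ambiguousAt.1 h).1 k
  simp only [Function.update_self, Function.update_of_ne hk] at h1 h2
  linarith

lemma card_ambiguousAt_of_mem_core {c : Fin n → ℝ} {η : ℝ} (hη : 0 ≤ η) {j : Fin n}
    (hj : c j = 1) :
    ((ambiguousAt c η N j).card : ℝ) * N ≤ N ^ n * (2 * η * N + 1) := by
  have := card_mul_le_of_fiber j (ambiguousAt c η N j) Finset.univ (q := 2 * η * N + 1)
    (fun _ _ _ => Finset.mem_univ _) (fun T _ => card_le_of_diam _ (by positivity) ?_)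
  · simpa using this
  · intro x hx y hy
    have := diam_ambiguousAt (Finset.mem_filter.1 hx).2 (Finset.mem_filter.1 hy).2
    rwa [hj, one_mul] at this

/-- Discrete form of the integral of u²·(2η/u). The factor y² comes from two core tickets bounded by
the third, and it absorbs the singularity 1/y. -/
lemma sum_sq_div_le (N : ℕ) (η : ℝ) (hη : 0 ≤ η) :
    ∑ y ∈ Finset.Ico 1 N, ((y : ℝ) + 1) ^ 2 * (2 * η * N * N / y + 1) ≤
      2 * η * N ^ 2 * (N ^ 2 / 2 + 3 * N) + N ^ 3 := by
  have h1 : ∀ y ∈ Finset.Ico 1 N, ((y : ℝ) + 1) ^ 2 * (2 * η * N * N / y + 1) ≤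
      2 * η * N ^ 2 * ((y : ℝ) + 3) + N ^ 2 := by
    intro y hy
    obtain ⟨hy1, hyN⟩ := Finset.mem_Ico.1 hy
    have hy1' : (1 : ℝ) ≤ y := by exact_mod_cast hy1
    have hyN' : (y : ℝ) + 1 ≤ N := by exact_mod_cast hyN
    have h2 : ((y : ℝ) + 1) ^ 2 / y ≤ y + 3 := by
      rw [div_le_iff₀ (by linarith)]; nlinarith
    have h3 : ((y : ℝ) + 1) ^ 2 ≤ N ^ 2 := by gcongr
    calc ((y : ℝ) + 1) ^ 2 * (2 * η * N * N / y + 1)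
        = 2 * η * N ^ 2 * (((y : ℝ) + 1) ^ 2 / y) + ((y : ℝ) + 1) ^ 2 := by ring
      _ ≤ _ := by gcongr
  -- The upper limit is decoupled from the `N` in the summand so that induction applies.
  have hgauss : ∀ M : ℕ, ∑ y ∈ Finset.Ico 1 M, (2 * η * N ^ 2 * ((y : ℝ) + 3) + N ^ 2) ≤
      2 * η * N ^ 2 * ((M : ℝ) ^ 2 / 2 + 3 * M) + M * N ^ 2 := by
    intro M
    induction M with
    | zero => simp
    | succ M ih =>
      rcases Nat.eq_zero_or_pos M with rfl | hM
      · simp; positivity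
      · rw [Finset.sum_Ico_succ_top hM]
        have : 0 ≤ 2 * η * (N : ℝ) ^ 2 := by positivity
        push_cast
        nlinarith
  refine (Finset.sum_le_sum h1).trans ((hgauss N).trans (le_of_eq ?_))
  ring

/-! ### Boxes of tickets described by their maximum over the core. -/

lemma card_filter_val_eq_le (y : ℕ) :
    ((Finset.univ.filter fun t : Fin N => (t : ℕ) = y).card : ℝ) ≤ 1 := by
  have : (Finset.univ.filter fun t : Fin N => (t : ℕ) = y).card ≤ 1 :=
    Finset.card_le_one.2 fun a ha b hb => by
      simp only [Finset.mem_filter, Finset.mem_univ, true_and] at ha hb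
      exact Fin.ext (ha.trans hb.symm)
  exact_mod_cast this

lemma card_filter_val_le {x : ℝ} (hx : 0 ≤ x) (S : Finset (Fin N))
    (hS : ∀ t ∈ S, ((t : ℕ) : ℝ) ≤ x) : (S.card : ℝ) ≤ x + 1 := by
  refine card_le_of_diam _ hx fun a _ b hb => ?_
  have : (0 : ℝ) ≤ ((a : ℕ) : ℝ) := by positivity
  linarith [hS b hb]

/-- The sides of the box of tickets whose maximum over `C` is `y`, attained at `e`. -/
def maxBox (C : Finset (Fin n)) (N : ℕ) (e : Fin n) (y : ℕ) (l : Fin n) : Finset (Fin N) :=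
  if l = e then Finset.univ.filter (fun t : Fin N => (t : ℕ) = y) else
    if l ∈ C then Finset.univ.filter (fun t : Fin N => (t : ℕ) ≤ y) else Finset.univ

lemma maxBox_self (C : Finset (Fin n)) (e : Fin n) (y : ℕ) :
    maxBox C N e y e = Finset.univ.filter (fun t : Fin N => (t : ℕ) = y) := if_pos rfl

lemma maxBox_of_mem {C : Finset (Fin n)} {e l : Fin n} (y : ℕ) (hl : l ∈ C) (hle : l ≠ e) :
    maxBox C N e y l = Finset.univ.filter (fun t : Fin N => (t : ℕ) ≤ y) := by
  rw [maxBox, if_neg hle, if_pos hl]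

lemma maxBox_of_notMem {C : Finset (Fin n)} {e l : Fin n} (y : ℕ) (he : e ∈ C) (hl : l ∉ C) :
    maxBox C N e y l = Finset.univ := by
  have hle : l ≠ e := fun h => hl (h ▸ he)
  rw [maxBox, if_neg hle, if_neg hl]

lemma mem_piFinset_maxBox {C : Finset (Fin n)} {e : Fin n} (he : e ∈ C) {T : Fin n → Fin N}
    (hmax : ∀ l ∈ C, (T l : ℕ) ≤ T e) : T ∈ Fintype.piFinset (maxBox C N e (T e)) := by
  refine Fintype.mem_piFinset.2 fun l => ?_
  by_cases hle : l = e
  · subst hle; rw [maxBox_self]; simp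
  · by_cases hl : l ∈ C
    · rw [maxBox_of_mem _ hl hle]; simpa using hmax l hl
    · rw [maxBox_of_notMem _ he hl]; exact Finset.mem_univ _

lemma card_maxBox {C : Finset (Fin n)} (hC : C.card = 3) {e : Fin n} (he : e ∈ C) (y : ℕ) :
    ((Fintype.piFinset (maxBox C N e y)).card : ℝ) * N ^ 3 ≤ N ^ n * ((y : ℝ) + 1) ^ 2 := by
  have h := card_box C (maxBox C N e y) (fun l hl => maxBox_of_notMem y he hl)
  rw [hC] at h
  rw [h, ← Finset.mul_prod_erase C _ he]
  have h1 : ((maxBox C N e y e).card : ℝ) ≤ 1 := by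
    rw [maxBox_self]; exact card_filter_val_eq_le y
  have h2 : ∏ l ∈ C.erase e, ((maxBox C N e y l).card : ℝ) ≤ ((y : ℝ) + 1) ^ 2 := by
    refine (Finset.prod_le_prod (g := fun _ => (y : ℝ) + 1) (fun _ _ => by positivity)
      fun l hl => ?_).trans ?_
    · obtain ⟨hle, hlC⟩ := Finset.mem_erase.1 hl
      rw [maxBox_of_mem y hlC hle]
      refine card_filter_val_le (by positivity) _ fun t ht => ?_
      exact_mod_cast (Finset.mem_filter.1 ht).2
    · rw [Finset.prod_const, Finset.card_erase_of_mem he, hC]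
  have h3 : (0 : ℝ) ≤ ∏ l ∈ C.erase e, ((maxBox C N e y l).card : ℝ) :=
    Finset.prod_nonneg fun _ _ => by positivity
  refine mul_le_mul_of_nonneg_left ?_ (by positivity)
  exact (mul_le_of_le_one_left h3 h1).trans h2

/-- Small tickets on all of `C`. -/
noncomputable def smallOn (C : Finset (Fin n)) (x : ℝ) (N : ℕ) : Finset (Fin n → Fin N) :=
  open Classical in Finset.univ.filter fun T => ∀ l ∈ C, ((T l : ℕ) : ℝ) ≤ x

lemma mem_smallOn {C : Finset (Fin n)} {x : ℝ} {T : Fin n → Fin N} :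
    T ∈ smallOn C x N ↔ ∀ l ∈ C, ((T l : ℕ) : ℝ) ≤ x := by
  simp [smallOn]

lemma card_smallOn (C : Finset (Fin n)) {x : ℝ} (hx : 0 ≤ x) (hN : 0 < N) :
    ((smallOn C x N).card : ℝ) ≤ N ^ n * ((x + 1) / N) ^ C.card := by
  classical
  have hN' : (0 : ℝ) < N := by exact_mod_cast hN
  let s : Fin n → Finset (Fin N) := fun l =>
    if l ∈ C then Finset.univ.filter (fun t => ((t : ℕ) : ℝ) ≤ x) else Finset.univ
  have hsub : smallOn C x N ⊆ Fintype.piFinset s := by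
    intro T hT
    have hT' := mem_smallOn.1 hT
    refine Fintype.mem_piFinset.2 fun l => ?_
    by_cases hl : l ∈ C
    · simpa [s, hl] using hT' l hl
    · simp [s, hl]
  have hcard : ((smallOn C x N).card : ℝ) ≤ (Fintype.piFinset s).card := by
    exact_mod_cast Finset.card_le_card hsub
  have h := card_box C s (fun l hl => by simp [s, hl])
  rw [div_pow, ← mul_div_assoc, le_div_iff₀ (by positivity)]
  calc ((smallOn C x N).card : ℝ) * N ^ C.card ≤ (Fintype.piFinset s).card * N ^ C.card := by
        gcongr
    _ = N ^ n * ∏ l ∈ C, ((s l).card : ℝ) := h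
    _ ≤ N ^ n * (x + 1) ^ C.card := by
        gcongr
        rw [← Finset.prod_const]
        refine Finset.prod_le_prod (fun _ _ => by positivity) fun l hl => ?_
        simp only [s, hl, if_true]
        exact card_filter_val_le hx _ fun t ht => (Finset.mem_filter.1 ht).2

/-- Ambiguous tickets whose maximum `y` over `C` is attained at `e`. -/
noncomputable def ambiguousSlice (C : Finset (Fin n)) (c : Fin n → ℝ) (η : ℝ) (N : ℕ)
    (j e : Fin n) (y : ℕ) : Finset (Fin n → Fin N) :=
  (ambiguousAt c η N j).filter fun T => T ∈ Fintype.piFinset (maxBox C N e y)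

lemma mem_ambiguousSlice {C : Finset (Fin n)} {c : Fin n → ℝ} {η : ℝ} {j e : Fin n} {y : ℕ}
    {T : Fin n → Fin N} : T ∈ ambiguousSlice C c η N j e y ↔
      T ∈ ambiguousAt c η N j ∧ T ∈ Fintype.piFinset (maxBox C N e y) :=
  Finset.mem_filter

/-- The winner `j` beats `e`, so y ≤ c_j·a ≤ c_j·N. This lower bound on c_j turns the bound on
products from `diam_ambiguousAt` into a bound on tickets. -/
lemma diam_ambiguousSlice {C : Finset (Fin n)} {c : Fin n → ℝ} {η : ℝ} (hη : 0 ≤ η)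
    {j e : Fin n} (hcC : ∀ l ∈ C, c l = 1) (hjC : j ∉ C) (he : e ∈ C) {y : ℕ} (hy : 0 < y)
    {T : Fin n → Fin N} {a b : Fin N}
    (ha : Function.update T j a ∈ ambiguousSlice C c η N j e y)
    (hb : Function.update T j b ∈ ambiguousSlice C c η N j e y) :
    ((b : ℕ) : ℝ) - ((a : ℕ) : ℝ) ≤ 2 * η * N * N / y := by
  have hej : e ≠ j := fun h => hjC (h ▸ he)
  have hy1 : (0 : ℝ) < y := by exact_mod_cast hy
  obtain ⟨ha', haT⟩ := mem_ambiguousSlice.1 ha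
  obtain ⟨hb', -⟩ := mem_ambiguousSlice.1 hb
  have hTe : (T e : ℕ) = y := by
    have := Fintype.mem_piFinset.1 haT e
    rw [maxBox_self, Function.update_of_ne hej] at this
    exact (Finset.mem_filter.1 this).2
  have hd := diam_ambiguousAt ha' hb'
  have hm := (mem_ambiguousAt.1 ha').1 e
  simp only [Function.update_self, Function.update_of_ne hej, hcC e he, one_mul, hTe] at hm
  have haN : ((a : ℕ) : ℝ) ≤ N := by exact_mod_cast a.2.le
  have hcj : 0 < c j := by
    by_contra hneg
    have : c j * ((a : ℕ) : ℝ) ≤ 0 :=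
      mul_nonpos_of_nonpos_of_nonneg (not_lt.1 hneg) (by positivity)
    linarith
  have hcN : (y : ℝ) ≤ c j * N := hm.trans (mul_le_mul_of_nonneg_left haN hcj.le)
  rcases le_total ((b : ℕ) : ℝ) ((a : ℕ) : ℝ) with hab | hab
  · exact (sub_nonpos.2 hab).trans (by positivity)
  · rw [le_div_iff₀ hy1]
    calc (((b : ℕ) : ℝ) - ((a : ℕ) : ℝ)) * y
        ≤ (((b : ℕ) : ℝ) - ((a : ℕ) : ℝ)) * (c j * N) :=
          mul_le_mul_of_nonneg_left hcN (sub_nonneg.2 hab)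
      _ = c j * (((b : ℕ) : ℝ) - ((a : ℕ) : ℝ)) * N := by ring
      _ ≤ 2 * η * N * N := mul_le_mul_of_nonneg_right hd (by positivity)

/-- As `j` is outside `C`, the box is a union of full lines in direction `j`, and
`card_mul_le_of_fiber` applies. The power N⁴ accounts for the three coordinates in `C` and the
coordinate `j`. -/
lemma card_ambiguousSlice {C : Finset (Fin n)} {c : Fin n → ℝ} {η : ℝ} (hη : 0 ≤ η)
    {j e : Fin n} (hC : C.card = 3) (hcC : ∀ l ∈ C, c l = 1) (hjC : j ∉ C) (he : e ∈ C)
    {y : ℕ} (hy : 0 < y) (hN : 0 < N) :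
    ((ambiguousSlice C c η N j e y).card : ℝ) ≤
      N ^ n / N ^ 4 * (((y : ℝ) + 1) ^ 2 * (2 * η * N * N / y + 1)) := by
  have hN' : (0 : ℝ) < N := by exact_mod_cast hN
  have hq : (0 : ℝ) ≤ 2 * η * N * N / y := by positivity
  have h := card_mul_le_of_fiber j (ambiguousSlice C c η N j e y)
    (Fintype.piFinset (maxBox C N e y)) (q := 2 * η * N * N / y + 1)
    (fun T hT t => by
      have hT' := Fintype.mem_piFinset.1 (mem_ambiguousSlice.1 hT).2
      refine Fintype.mem_piFinset.2 fun l => ?_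
      by_cases hl : l = j
      · subst hl; rw [maxBox_of_notMem y he hjC]; exact Finset.mem_univ _
      · rw [Function.update_of_ne hl]; exact hT' l)
    (fun T _ => card_le_of_diam _ hq fun a ha b hb =>
      diam_ambiguousSlice hη hcC hjC he hy (Finset.mem_filter.1 ha).2 (Finset.mem_filter.1 hb).2)
  rw [div_mul_eq_mul_div, le_div_iff₀ (by positivity)]
  calc ((ambiguousSlice C c η N j e y).card : ℝ) * N ^ 4
      = (ambiguousSlice C c η N j e y).card * N * N ^ 3 := by ring
    _ ≤ (Fintype.piFinset (maxBox C N e y)).card * (2 * η * N * N / y + 1) * N ^ 3 :=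
        mul_le_mul_of_nonneg_right h (by positivity)
    _ = (Fintype.piFinset (maxBox C N e y)).card * N ^ 3 * (2 * η * N * N / y + 1) := by ring
    _ ≤ N ^ n * ((y : ℝ) + 1) ^ 2 * (2 * η * N * N / y + 1) :=
        mul_le_mul_of_nonneg_right (card_maxBox hC he y) (by positivity)
    _ = _ := by ring

/-- Outside the core: compare with three members of the core. -/
lemma card_ambiguousAt_of_three {c : Fin n → ℝ} {η : ℝ} (hη : 0 ≤ η) {j : Fin n}
    {C : Finset (Fin n)} (hC : C.card = 3) (hcC : ∀ l ∈ C, c l = 1) (hjC : j ∉ C) (hN : 0 < N) :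
    ((ambiguousAt c η N j).card : ℝ) ≤ N ^ n * (3 * η + (18 * η + 4) / N) := by
  classical
  have hN' : (0 : ℝ) < N := by exact_mod_cast hN
  have hN1 : (1 : ℝ) ≤ N := by exact_mod_cast hN
  -- The slices cover only a positive maximum over `C`, since their bound divides by it; tuples
  -- vanishing on `C` are counted separately. Ties for the maximum make slices overlap, which is
  -- harmless.
  have hcover : ambiguousAt c η N j ⊆ smallOn C 0 N ∪
      C.biUnion fun e => (Finset.Ico 1 N).biUnion fun y => ambiguousSlice C c η N j e y := by
    intro T hT
    have hCne : C.Nonempty := Finset.card_pos.1 (by omega)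
    obtain ⟨e, he, hmax⟩ := C.exists_max_image (fun l => (T l : ℕ)) hCne
    rcases Nat.eq_zero_or_pos (T e : ℕ) with h0 | hpos
    · refine Finset.mem_union_left _ (mem_smallOn.2 fun l hl => ?_)
      have := hmax l hl
      rw [h0] at this
      exact_mod_cast this
    · refine Finset.mem_union_right _ ?_
      simp only [Finset.mem_biUnion]
      exact ⟨e, he, T e, Finset.mem_Ico.2 ⟨hpos, (T e).2⟩,
        mem_ambiguousSlice.2 ⟨hT, mem_piFinset_maxBox he hmax⟩⟩
  have hzero : ((smallOn C 0 N).card : ℝ) ≤ N ^ n / N := by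
    refine (card_smallOn C le_rfl hN).trans ?_
    rw [hC, div_eq_mul_one_div ((N : ℝ) ^ n) (N : ℝ), zero_add]
    gcongr
    exact pow_le_of_le_one (by positivity) ((div_le_one hN').2 hN1) (by norm_num)
  have h1 : ((ambiguousAt c η N j).card : ℝ) ≤ (smallOn C 0 N).card +
      ∑ e ∈ C, ∑ y ∈ Finset.Ico 1 N, ((ambiguousSlice C c η N j e y).card : ℝ) := by
    have := (Finset.card_le_card hcover).trans ((Finset.card_union_le _ _).trans
      (Nat.add_le_add_left (Finset.card_biUnion_le.trans
        (Finset.sum_le_sum fun e _ => Finset.card_biUnion_le)) _))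
    exact_mod_cast this
  have h2 : ∑ e ∈ C, ∑ y ∈ Finset.Ico 1 N, ((ambiguousSlice C c η N j e y).card : ℝ) ≤
      3 * (N ^ n / N ^ 4 * (2 * η * N ^ 2 * (N ^ 2 / 2 + 3 * N) + N ^ 3)) := by
    refine (Finset.sum_le_card_nsmul _ _
      (N ^ n / N ^ 4 * (2 * η * N ^ 2 * (N ^ 2 / 2 + 3 * N) + N ^ 3)) fun e he => ?_).trans ?_
    · refine (Finset.sum_le_sum fun y hy =>
        card_ambiguousSlice hη hC hcC hjC he (Finset.mem_Ico.1 hy).1 hN).trans ?_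
      rw [← Finset.mul_sum]
      exact mul_le_mul_of_nonneg_left (sum_sq_div_le N η hη) (by positivity)
    · rw [hC, nsmul_eq_mul]; norm_num
  -- The rounding term 4/N is 1/N from the zero tuples and 3/N from the three choices of `e`.
  calc ((ambiguousAt c η N j).card : ℝ) ≤ N ^ n / N +
        3 * (N ^ n / N ^ 4 * (2 * η * N ^ 2 * (N ^ 2 / 2 + 3 * N) + N ^ 3)) := by linarith
    _ = N ^ n * (3 * η + (18 * η + 4) / N) := by
      field_simp
      ring

/-- The tickets for which the maximum of the products with the coefficients `c` is not clear. -/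
noncomputable def ambiguous (c : Fin n → ℝ) (η : ℝ) (N : ℕ) : Finset (Fin n → Fin N) :=
  open Classical in Finset.univ.biUnion fun j => ambiguousAt c η N j

lemma card_ambiguous {c : Fin n → ℝ} {η : ℝ} (hη : 0 ≤ η) {C : Finset (Fin n)}
    (hC : 3 ≤ C.card) (hcC : ∀ l ∈ C, c l = 1) (hN : 0 < N) :
    ((ambiguous c η N).card : ℝ) ≤ N ^ n * (n * (3 * η + (18 * η + 4) / N)) := by
  have hN' : (0 : ℝ) < N := by exact_mod_cast hN
  have key : ∀ j, ((ambiguousAt c η N j).card : ℝ) ≤ N ^ n * (3 * η + (18 * η + 4) / N) := by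
    intro j
    by_cases hj : j ∈ C
    · have h := card_ambiguousAt_of_mem_core (N := N) hη (hcC j hj)
      rw [← le_div_iff₀ hN'] at h
      refine h.trans ?_
      rw [mul_div_assoc]
      gcongr
      have : (2 * η * N + 1) / N = 2 * η + 1 / N := by field_simp
      rw [this]
      gcongr <;> linarith
    · obtain ⟨C', hC', hcard⟩ := Finset.exists_subset_card_eq hC
      exact card_ambiguousAt_of_three hη hcard (fun l hl => hcC l (hC' hl))
        (fun h => hj (hC' h)) hN
  have h1 : ((ambiguous c η N).card : ℝ) ≤ ∑ j : Fin n, ((ambiguousAt c η N j).card : ℝ) := by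
    have := Finset.card_biUnion_le (s := (Finset.univ : Finset (Fin n)))
      (t := fun j => ambiguousAt c η N j)
    unfold ambiguous
    exact_mod_cast this
  refine h1.trans ((Finset.sum_le_card_nsmul _ _ _ fun j _ => key j).trans (le_of_eq ?_))
  rw [nsmul_eq_mul, Finset.card_univ, Fintype.card_fin]
  ring

end Counting

/-! ### Stability of the selection under changes of the weights -/

/-- Up to a fraction `β` of the tickets, the selected process does not depend on the choice of
admissible weights that differ from given ones by at most the precision. -/
def Protocol.Stable (P : Protocol n D lam) (β : ℝ) : Prop :=
  ∀ (C : Finset (Fin n)) (w₀ : Fin n → ℝ), n - P.f ≤ C.card → Admissible C w₀ →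
    ∃ bad : Finset (Fin n → Fin (2 ^ lam)), (bad.card : ℝ) ≤ β * ((2 ^ lam : ℕ) : ℝ) ^ n ∧
      ∀ T ∉ bad, ∀ w, Admissible C w → (∀ j, |w j - w₀ j| ≤ P.eps) →
        P.select T w = P.select T w₀

lemma Protocol.Stable.mono {P : Protocol n D lam} {β β' : ℝ} (h : P.Stable β) (hβ : β ≤ β') :
    P.Stable β' := by
  intro C w₀ hC hw₀
  obtain ⟨bad, hbad, h'⟩ := h C w₀ hC hw₀
  exact ⟨bad, hbad.trans (by gcongr), h'⟩

/-- Without faults the core contains every process, so all admissible weights coincide. The case is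
separate because the core may then have fewer than three members. -/
lemma stable_of_no_fault {P : Protocol n D lam} (hf : P.f = 0) : P.Stable 0 := by
  intro C w₀ hC hw₀
  refine ⟨∅, by simp, fun T _ w hw _ => ?_⟩
  have hle : C.card ≤ n := by simpa using Finset.card_le_univ C
  have huniv : C = Finset.univ := Finset.eq_univ_of_card C (by rw [Fintype.card_fin]; omega)
  have : w = w₀ := funext fun j => by
    rw [hw.1 j (huniv ▸ Finset.mem_univ j), hw₀.1 j (huniv ▸ Finset.mem_univ j)]
  rw [this]

lemma notMem_ambiguous {N : ℕ} {c : Fin n → ℝ} {η : ℝ} {T : Fin n → Fin N}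
    (hT : T ∉ ambiguous c η N) {j k : Fin n} (hj : ∀ l, c l * (T l : ℕ) ≤ c j * (T j : ℕ))
    (hjk : c j * (T j : ℕ) ≤ c k * (T k : ℕ) + 2 * η * N) : k = j := by
  by_contra hne
  exact hT (Finset.mem_biUnion.2 ⟨j, Finset.mem_univ j, mem_ambiguousAt.2 ⟨hj, k, hne, hjk⟩⟩)

/-- The perturbation of a product when the coefficients change by at most `η`. -/
lemma perturb_le {N : ℕ} {a a' b b' η : ℝ} {s t : Fin N} (hη : 0 ≤ η) (ha : a ≤ a' + η)
    (hb : b' ≤ b + η) (h : a' * (s : ℕ) ≤ b' * (t : ℕ)) :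
    a * (s : ℕ) ≤ b * (t : ℕ) + 2 * η * N := by
  have hs : ((s : ℕ) : ℝ) ≤ N := by exact_mod_cast s.2.le
  have ht : ((t : ℕ) : ℝ) ≤ N := by exact_mod_cast t.2.le
  calc a * (s : ℕ) ≤ (a' + η) * (s : ℕ) := by gcongr
    _ = a' * (s : ℕ) + η * (s : ℕ) := by ring
    _ ≤ b' * (t : ℕ) + η * N := by gcongr
    _ ≤ (b + η) * (t : ℕ) + η * N := by gcongr
    _ = b * (t : ℕ) + η * (t : ℕ) + η * N := by ring
    _ ≤ b * (t : ℕ) + η * N + η * N := by gcongr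
    _ = _ := by ring

/-- If `w` selects k and `w₀` selects j, then moving from `w` to `w₀` costs at most εN on each of
the two products. So k is within 2εN of the winner j, and tickets that are not ambiguous force k =
j. -/
lemma stable_of_calibrate_id {P : Protocol n D lam} (ham : IsArgmax P.argmax)
    (hcal : P.calibrate = id) (hf : 1 ≤ P.f) (hfn : 3 * P.f < n) :
    P.Stable (n * (3 * P.eps + (18 * P.eps + 4) / ((2 ^ lam : ℕ) : ℝ))) := by
  intro C w₀ hC hw₀
  have hne : C.Nonempty := Finset.card_pos.1 (by omega)
  refine ⟨ambiguous w₀ P.eps (2 ^ lam), ?_, fun T hT w hw hclose => ?_⟩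
  · rw [mul_comm]
    exact card_ambiguous P.eps_pos.le (by omega) hw₀.1 (by positivity)
  -- The selected process maximizes over all processes and not only over candidates: a zero weight
  -- gives the product 0.
  · have hle : ∀ {u : Fin n → ℝ}, Admissible C u → ∀ l,
        u l * (T l : ℕ) ≤ u (P.select T u) * (T (P.select T u) : ℕ) := by
      intro u hu l
      rcases (hu.2 l).1.eq_or_lt with h0 | hpos
      · rw [← h0, zero_mul]
        exact mul_nonneg (hu.2 _).1 (by positivity)
      · simpa [hcal] using P.le_select ham T hpos
    refine notMem_ambiguous hT (hle hw₀)
      (perturb_le P.eps_pos.le ?_ ?_ (hle hw (P.select T w₀)))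
    · linarith [(abs_le.1 (hclose (P.select T w₀))).1]
    · linarith [(abs_le.1 (hclose (P.select T w))).2]

/-! ### The calibration function on positive weights. -/

lemma calibration_of_pos {ε v w : ℝ} (hw : 0 < w) :
    calibration ε v w = (w - ε) / (1 - ε) + (1 - w) / (1 - ε) * v := if_neg hw.ne'

lemma calibration_one {ε v : ℝ} (hε : ε < 1) : calibration ε v 1 = 1 := by
  rw [calibration_of_pos one_pos, sub_self, zero_div, zero_mul, add_zero,
    div_self (sub_pos.2 hε).ne']

lemma calibration_le_of_le {ε v w : ℝ} (hε : ε < 1) (hv : v ≤ 1) (hw : 0 < w) (hwε : w ≤ ε) :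
    calibration ε v w ≤ v := by
  rw [calibration_of_pos hw, div_mul_eq_mul_div, ← add_div, div_le_iff₀ (by linarith)]
  nlinarith

/-- The slope is (1-v)/(1-ε). Both weights must be positive, because the function jumps at 0. -/
lemma calibration_le_add {ε v w w' : ℝ} (hε : ε < 1) (hv : v ≤ 1) (hw : 0 < w) (hw' : 0 < w')
    (h : w ≤ w' + ε) : calibration ε v w ≤ calibration ε v w' + (1 - v) * ε / (1 - ε) := by
  rw [calibration_of_pos hw, calibration_of_pos hw', div_mul_eq_mul_div, ← add_div,
    div_mul_eq_mul_div, ← add_div, ← add_div]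
  refine div_le_div_of_nonneg_right ?_ (by linarith)
  nlinarith

lemma pow_le_pow_add {a b : ℝ} (hb : 0 ≤ b) (hab : b ≤ a) (ha : a ≤ 1) (m : ℕ) :
    a ^ m ≤ b ^ m + m * (a - b) := by
  induction m with
  | zero => simp
  | succ m ih =>
    have h0 : 0 ≤ a := hb.trans hab
    have h1 : b ^ m ≤ 1 := pow_le_one₀ hb (hab.trans ha)
    have h2 : (0 : ℝ) ≤ m * (a - b) := mul_nonneg (by positivity) (by linarith)
    have h3 : a * a ^ m ≤ a * (b ^ m + m * (a - b)) := mul_le_mul_of_nonneg_left ih h0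
    have h4 : a * (m * (a - b)) ≤ m * (a - b) := mul_le_of_le_one_left h2 ha
    have h5 : b ^ m * (a - b) ≤ a - b := mul_le_of_le_one_left (by linarith) h1
    push_cast
    rw [pow_succ', pow_succ']
    nlinarith

/-- A ticket is at most v(N-1) for at most v(N-1)+1 of its N values, a fraction exceeding v by at
most (1-v)/N. By `pow_le_pow_add` this rounding adds at most n/N to the power. -/
lemma card_smallOn_le {N m : ℕ} {v : ℝ} (hv : 0 ≤ v) (hv1 : v ≤ 1) (hN : 0 < N)
    {C : Finset (Fin n)} (hC : m ≤ C.card) (hm : m ≤ n) :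
    ((smallOn C (v * (N - 1)) N).card : ℝ) ≤ N ^ n * (v ^ m + n / N) := by
  have hN1 : (1 : ℝ) ≤ N := by exact_mod_cast hN
  have hN' : (0 : ℝ) < N := by linarith
  have hx : 0 ≤ v * ((N : ℝ) - 1) := mul_nonneg hv (by linarith)
  refine (card_smallOn C hx hN).trans ?_
  set a : ℝ := (v * (N - 1) + 1) / N with ha
  have hav : a - v = (1 - v) / N := by rw [ha]; field_simp; ring
  have h0 : 0 ≤ a := by positivity
  have hva : v ≤ a := by
    have : 0 ≤ (1 - v) / N := div_nonneg (by linarith) hN'.le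
    linarith
  have ha1 : a ≤ 1 := by
    rw [ha, div_le_one hN']
    nlinarith
  refine mul_le_mul_of_nonneg_left ?_ (by positivity)
  refine (pow_le_pow_of_le_one h0 ha1 hC).trans ((pow_le_pow_add hv hva ha1 m).trans ?_)
  rw [hav, ← mul_div_assoc]
  gcongr
  calc (m : ℝ) * (1 - v) ≤ m * 1 := by gcongr; linarith
    _ ≤ n := by rw [mul_one]; exact_mod_cast hm

/-- Outside the tickets that are small on the whole core, each selected process has weight above ε
in its own view, hence positive weight in the other view. All four calibrated weights then lie on
the affine branch, and the comparison runs as without calibration, with η in place of ε. -/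
lemma stable_of_calibration {P : Protocol n D lam} (ham : IsArgmax P.argmax) {v : ℝ}
    (hv : 0 ≤ v) (hv1 : v ≤ 1) (hε : P.eps < 1) (hcal : P.calibrate = calibration P.eps v)
    (hf : 1 ≤ P.f) (hfn : 3 * P.f < n) :
    P.Stable (v ^ (n - P.f) + n / ((2 ^ lam : ℕ) : ℝ) +
      n * (3 * ((1 - v) * P.eps / (1 - P.eps)) +
        (18 * ((1 - v) * P.eps / (1 - P.eps)) + 4) / ((2 ^ lam : ℕ) : ℝ))) := by
  classical
  intro C w₀ hC hw₀
  have hεpos := P.eps_pos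
  have hne : C.Nonempty := Finset.card_pos.1 (by omega)
  set N : ℕ := 2 ^ lam with hN
  have hNpos : 0 < N := by positivity
  set η := (1 - v) * P.eps / (1 - P.eps) with hη
  have hη0 : 0 ≤ η := div_nonneg (mul_nonneg (by linarith) hεpos.le) (by linarith)
  set c : Fin n → ℝ := fun l => calibration P.eps v (w₀ l) with hc
  have hcC : ∀ l ∈ C, c l = 1 := fun l hl => by
    simp only [hc]; rw [hw₀.1 l hl, calibration_one hε]
  refine ⟨smallOn C (v * (N - 1)) N ∪ ambiguous c η N, ?_, fun T hT w hw hclose => ?_⟩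
  · have h1 := card_smallOn_le hv hv1 hNpos hC (Nat.sub_le n P.f)
    have h2 := card_ambiguous (c := c) hη0 (C := C) (by omega) hcC hNpos
    have h3 : ((smallOn C (v * (N - 1)) N ∪ ambiguous c η N).card : ℝ) ≤
        (smallOn C (v * (N - 1)) N).card + (ambiguous c η N).card := by
      exact_mod_cast Finset.card_union_le _ _
    exact h3.trans ((add_le_add h1 h2).trans
      (le_of_eq ((mul_add _ _ _).symm.trans (mul_comm _ _))))
  · rw [Finset.mem_union, not_or] at hT
    obtain ⟨hT1, hT2⟩ := hT
    have hle : ∀ {u : Fin n → ℝ}, ∀ {l}, 0 < u l → calibration P.eps v (u l) * (T l : ℕ) ≤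
        calibration P.eps v (u (P.select T u)) * (T (P.select T u) : ℕ) := by
      intro u l hl
      simpa [hcal] using P.le_select ham T hl
    have hcore : ∀ {u : Fin n → ℝ}, Admissible C u → ∀ l ∈ C, ((T l : ℕ) : ℝ) ≤
        calibration P.eps v (u (P.select T u)) * (T (P.select T u) : ℕ) := by
      intro u hu l hl
      have hul := hu.1 l hl
      have := hle (u := u) (l := l) (by rw [hul]; norm_num)
      rwa [hul, calibration_one hε, one_mul] at this
    -- Otherwise the winning product is at most v(N-1); as it dominates all core tickets, these
    -- would all be small.
    have hbig : ∀ {u : Fin n → ℝ}, Admissible C u → P.eps < u (P.select T u) := by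
      intro u hu
      by_contra hsmall
      have hpos := P.select_mem ham T (hu.candidates_nonempty hne)
      have hcv := calibration_le_of_le hε hv1 hpos (not_lt.1 hsmall)
      refine hT1 (mem_smallOn.2 fun l hl => (hcore hu l hl).trans ?_)
      have hlt : ((T (P.select T u) : ℕ) : ℝ) ≤ N - 1 := by
        have : (T (P.select T u) : ℕ) + 1 ≤ N := (T (P.select T u)).2
        have : (((T (P.select T u) : ℕ) : ℝ)) + 1 ≤ N := by exact_mod_cast this
        linarith
      calc _ ≤ v * ((T (P.select T u) : ℕ) : ℝ) := by gcongr
        _ ≤ _ := by gcongr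
    have hj₀ := hbig hw₀
    have hk := hbig hw
    have hclose₁ := abs_le.1 (hclose (P.select T w₀))
    have hclose₂ := abs_le.1 (hclose (P.select T w))
    have hwj : 0 < w (P.select T w₀) := by linarith
    have hwk : 0 < w₀ (P.select T w) := by linarith
    refine notMem_ambiguous hT2 (fun l => ?_) (perturb_le hη0
      (calibration_le_add hε hv1 (hεpos.trans hj₀) hwj (by linarith))
      (calibration_le_add hε hv1 (hεpos.trans hk) hwk (by linarith)) (hle hwj))
    -- A calibrated weight may be negative, so nonnegativity of the winning product is derived from
    -- the core.
    rcases (hw₀.2 l).1.eq_or_lt with h0 | hpos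
    · simp only [hc]
      rw [← h0]
      obtain ⟨e, he⟩ := hne
      have : (0 : ℝ) ≤ ((T e : ℕ) : ℝ) := by positivity
      have h0' : calibration P.eps v 0 = 0 := if_pos rfl
      rw [h0', zero_mul]
      exact this.trans (hcore hw₀ e he)
    · exact hle hpos

/-! ### The parameters of the two versions -/

lemma eps_uncalibrated_le {f : ℕ} {δ : ℝ} {am : Finset (Fin n) → (Fin n → ℝ) → Fin n}
    (hn : 0 < n) (hδ1 : δ < 1) :
    8 * n * (uncalibrated n D lam f am δ).eps ≤ 1 - δ := by
  have hn' : (0 : ℝ) < n := by exact_mod_cast hn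
  have hδ : 0 < 1 - δ := by linarith
  set r : ℕ := ⌈Real.logb 2 n + Real.logb 2 (1 / (1 - δ))⌉₊ with hr
  have h1 : (n : ℝ) * (1 / (1 - δ)) ≤ 2 ^ r := by
    have : Real.logb 2 (n * (1 / (1 - δ))) ≤ r := by
      rw [Real.logb_mul hn'.ne' (by positivity)]
      exact Nat.le_ceil _
    rw [Real.logb_le_iff_le_rpow (by norm_num) (by positivity)] at this
    exact_mod_cast this
  have h2 : (uncalibrated n D lam f am δ).eps = ((2 : ℝ) ^ (3 + r))⁻¹ := rfl
  rw [h2, ← div_eq_mul_inv, div_le_iff₀ (by positivity), pow_add]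
  rw [mul_one_div, div_le_iff₀ hδ] at h1
  linarith

lemma log_two_div {δ : ℝ} (hδ1 : δ < 1) :
    Real.log (2 / (1 - δ)) = Real.log 2 * (1 + Real.logb 2 (1 / (1 - δ))) := by
  have hδ : 1 - δ ≠ 0 := by linarith
  have h2 : Real.log 2 ≠ 0 := (Real.log_pos (by norm_num)).ne'
  rw [div_eq_mul_one_div, Real.log_mul (by norm_num) (by positivity), Real.logb]
  field_simp

lemma logb_pos_of_pos {δ : ℝ} (hδ0 : 0 < δ) (hδ1 : δ < 1) : 0 < Real.logb 2 (1 / (1 - δ)) :=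
  Real.logb_pos (by norm_num) (by rw [lt_div_iff₀ (by linarith)]; linarith)

lemma inv_two_pow_calibratedRounds_le (δ : ℝ) : ((2 : ℝ) ^ calibratedRounds δ)⁻¹ ≤ 1 / 16 := by
  rw [one_div]
  gcongr
  calc (16 : ℝ) = 2 ^ 4 := by norm_num
    _ ≤ 2 ^ calibratedRounds δ := by
      gcongr
      · norm_num
      · exact le_max_left _ _

/-- With ℓ = log₂(1/(1-δ)), exponentiating 5 + ℓ + log₂ ℓ gives 32·ℓ/(1-δ). -/
lemma inv_two_pow_calibratedRounds_mul_le {δ : ℝ} (hδ0 : 0 < δ) (hδ1 : δ < 1) :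
    32 * Real.logb 2 (1 / (1 - δ)) * ((2 : ℝ) ^ calibratedRounds δ)⁻¹ ≤ 1 - δ := by
  have hδ : 0 < 1 - δ := by linarith
  set ℓ := Real.logb 2 (1 / (1 - δ)) with hℓ
  have hpos : 0 < ℓ := logb_pos_of_pos hδ0 hδ1
  have h1 : 5 + (ℓ + Real.logb 2 ℓ) ≤ (calibratedRounds δ : ℝ) := by
    have h2 : ((5 + ⌈ℓ + Real.logb 2 ℓ⌉ : ℤ) : ℝ) ≤ (calibratedRounds δ : ℝ) := by
      have : (5 + ⌈ℓ + Real.logb 2 ℓ⌉ : ℤ) ≤ (calibratedRounds δ : ℤ) :=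
        (Int.self_le_toNat _).trans (by exact_mod_cast le_max_right 4 _)
      exact_mod_cast this
    refine le_trans ?_ h2
    push_cast
    linarith [Int.le_ceil (ℓ + Real.logb 2 ℓ)]
  have h3 : (2 : ℝ) ^ (5 + (ℓ + Real.logb 2 ℓ)) ≤ 2 ^ calibratedRounds δ := by
    rw [← Real.rpow_natCast]
    exact Real.rpow_le_rpow_of_exponent_le (by norm_num) h1
  rw [Real.rpow_add (by norm_num), Real.rpow_add (by norm_num),
    Real.rpow_logb (by norm_num) (by norm_num) hpos, hℓ,
    Real.rpow_logb (by norm_num) (by norm_num) (by positivity), ← hℓ] at h3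
  rw [← div_eq_mul_inv, div_le_iff₀ (by positivity)]
  have h4 : (2 : ℝ) ^ (5 : ℝ) = 32 := by norm_num
  rw [h4, one_div_mul_eq_div, ← mul_div_assoc, div_le_iff₀ hδ] at h3
  linarith

/-- Here L = ln 2·(1+ℓ). For ℓ ≥ 1/2 one has 1+ℓ ≤ 3ℓ, and the bound on ℓε suffices. For small ℓ
that bound is useless, as log₂ ℓ tends to -∞; there the minimum of four rounds gives ε ≤ 1/16, while
1-δ ≥ 7/10. -/
lemma log_mul_inv_two_pow_le {δ : ℝ} (hδ0 : 0 < δ) (hδ1 : δ < 1) :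
    48 * (Real.log (2 / (1 - δ)) * ((2 : ℝ) ^ calibratedRounds δ)⁻¹) ≤ 5 * (1 - δ) := by
  have h1 := inv_two_pow_calibratedRounds_le δ
  have h2 := inv_two_pow_calibratedRounds_mul_le hδ0 hδ1
  have hpos := logb_pos_of_pos hδ0 hδ1
  have hlog := Real.log_two_lt_d9
  have hlog0 : 0 < Real.log 2 := Real.log_pos (by norm_num)
  rw [log_two_div hδ1]
  have hε : 0 < ((2 : ℝ) ^ calibratedRounds δ)⁻¹ := by positivity
  set ε := ((2 : ℝ) ^ calibratedRounds δ)⁻¹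
  set ℓ := Real.logb 2 (1 / (1 - δ)) with hℓ
  have h3 : Real.log 2 * (1 + ℓ) * ε ≤ 7 / 10 * ((1 + ℓ) * ε) := by
    rw [mul_assoc]; gcongr; linarith
  rcases le_total (1 / 2) ℓ with h | h
  · have h4 : (1 + ℓ) * ε ≤ 3 * ℓ * ε := by gcongr; linarith
    linarith
  · have h4 : (1 + ℓ) * ε ≤ (3 / 2) * (1 / 16) := by gcongr; linarith
    have h5 : 7 / 10 ≤ 1 - δ := by
      rw [hℓ, Real.logb_le_iff_le_rpow (by norm_num) (by positivity), ← Real.sqrt_eq_rpow,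
        div_le_iff₀ (by linarith)] at h
      have h6 : Real.sqrt 2 ≤ 10 / 7 := (Real.sqrt_le_left (by norm_num)).2 (by norm_num)
      nlinarith
    linarith

/-- From 1-x ≤ exp(-x) and n-f ≥ 2n/3; the parameter v is chosen so that the result is exp(-L). -/
lemma pow_calibrated_le {f : ℕ} {δ : ℝ} (hfn : 3 * f < n) (hδ0 : 0 < δ) (hδ1 : δ < 1)
    (hv : 0 ≤ 1 - Real.log (2 / (1 - δ)) / (2 * n / 3)) :
    (1 - Real.log (2 / (1 - δ)) / (2 * n / 3)) ^ (n - f) ≤ (1 - δ) / 2 := by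
  have hδ : 0 < 1 - δ := by linarith
  have hn : (0 : ℝ) < n := by exact_mod_cast (by omega : 0 < n)
  set L := Real.log (2 / (1 - δ)) with hL
  have hL0 : 0 ≤ L := Real.log_nonneg (by rw [le_div_iff₀ hδ]; linarith)
  have h1 : 1 - L / (2 * n / 3) ≤ Real.exp (-(L / (2 * n / 3))) := by
    linarith [Real.add_one_le_exp (-(L / (2 * n / 3)))]
  have h2 : (2 * n / 3 : ℝ) ≤ ((n - f : ℕ) : ℝ) := by
    have : 2 * n ≤ 3 * (n - f) := by omega
    have : (2 * n : ℝ) ≤ 3 * ((n - f : ℕ) : ℝ) := by exact_mod_cast this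
    linarith
  calc (1 - L / (2 * n / 3)) ^ (n - f) ≤ Real.exp (-(L / (2 * n / 3))) ^ (n - f) := by gcongr
    _ = Real.exp (-(((n - f : ℕ) : ℝ) * (L / (2 * n / 3)))) := by
        rw [← Real.exp_nat_mul]; ring_nf
    _ ≤ Real.exp (-L) := by
        rw [Real.exp_le_exp, neg_le_neg_iff]
        calc L = (2 * n / 3) * (L / (2 * n / 3)) := by field_simp
          _ ≤ _ := by gcongr
    _ = (1 - δ) / 2 := by
        rw [hL, Real.exp_neg, Real.exp_log (by positivity), inv_div]

lemma mul_rounding_le {x : ℝ} (hx : x ≤ 1) (n N : ℕ) :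
    (n : ℝ) * ((18 * x + 4) / N) ≤ 22 * n / N := by
  rw [← mul_div_assoc, mul_comm (22 : ℝ)]
  gcongr
  linarith

lemma stable_uncalibrated {f : ℕ} {δ : ℝ} {am : Finset (Fin n) → (Fin n → ℝ) → Fin n}
    (hfn : 3 * f < n) (hδ1 : δ < 1) (ham : IsArgmax am) :
    (uncalibrated n D lam f am δ).Stable (1 - δ + 23 * n / ((2 ^ lam : ℕ) : ℝ)) := by
  have hδ : 0 < 1 - δ := by linarith
  set P := uncalibrated n D lam f am δ with hP
  rcases Nat.eq_zero_or_pos f with hf | hf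
  · exact (stable_of_no_fault (P := P) hf).mono (by positivity)
  · refine (stable_of_calibrate_id (P := P) ham rfl hf hfn).mono ?_
    have h := eps_uncalibrated_le (D := D) (lam := lam) (f := f) (am := am) (δ := δ)
      (n := n) (by omega) hδ1
    rw [← hP] at h
    have hε : P.eps ≤ 1 := inv_le_one_of_one_le₀ (one_le_pow₀ (by norm_num))
    have h2 := mul_rounding_le hε n (2 ^ lam)
    have h3 : (22 * n : ℝ) / ((2 ^ lam : ℕ) : ℝ) ≤ 23 * n / ((2 ^ lam : ℕ) : ℝ) := by
      gcongr; norm_num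
    rw [mul_add]
    linarith

/-- The failure probability 1-δ is split in two halves. One pays for small core tickets, the other
for ambiguity: 3nη ≤ 3·(8/5)·Lε ≤ (1-δ)/2. If n ≤ 3L/2, calibration is off and 3nε ≤ (9/2)·Lε
suffices. The 23 in the rounding term is 1 for small tickets plus 22 = 18+4 for ambiguity. -/
lemma stable_calibrated {f : ℕ} {δ : ℝ} {am : Finset (Fin n) → (Fin n → ℝ) → Fin n}
    (hfn : 3 * f < n) (hδ0 : 0 < δ) (hδ1 : δ < 1) (ham : IsArgmax am) :
    (calibrated n D lam f am δ).Stable (1 - δ + 23 * n / ((2 ^ lam : ℕ) : ℝ)) := by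
  have hδ : 0 < 1 - δ := by linarith
  have hn : (0 : ℝ) < n := by exact_mod_cast (by omega : 0 < n)
  set P := calibrated n D lam f am δ with hP
  have hPε : P.eps = ((2 : ℝ) ^ calibratedRounds δ)⁻¹ := rfl
  have hε0 := P.eps_pos
  have hε16 : P.eps ≤ 1 / 16 := inv_two_pow_calibratedRounds_le δ
  have hLε := log_mul_inv_two_pow_le hδ0 hδ1
  rw [← hPε] at hLε
  set L := Real.log (2 / (1 - δ)) with hL
  have hL0 : 0 ≤ L := Real.log_nonneg (by rw [le_div_iff₀ hδ]; linarith)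
  rcases Nat.eq_zero_or_pos f with hf | hf
  · exact (stable_of_no_fault (P := P) hf).mono (by positivity)
  by_cases hcase : 3 * L / 2 < n
  · have hcal : P.calibrate = calibration P.eps (1 - L / (2 * n / 3)) := if_pos hcase
    have hu1 : L / (2 * n / 3) ≤ 1 := by
      rw [div_le_one (by positivity)]; linarith
    have hu0 : 0 ≤ L / (2 * n / 3) := by positivity
    refine (stable_of_calibration (P := P) ham (by linarith) (by linarith) (by linarith) hcal
      hf hfn).mono ?_
    have hpow : (1 - L / (2 * n / 3)) ^ (n - P.f) ≤ (1 - δ) / 2 :=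
      pow_calibrated_le hfn hδ0 hδ1 (by linarith)
    have hsub : 1 - (1 - L / (2 * n / 3)) = L / (2 * n / 3) := by ring
    rw [hsub]
    set η := L / (2 * n / 3) * P.eps / (1 - P.eps) with hη
    -- 8/5 = (3/2)·(16/15), the second factor bounding 1/(1-ε) for ε ≤ 1/16.
    have hη1 : n * η ≤ 8 / 5 * (L * P.eps) := by
      have : n * η = 3 / 2 * (L * P.eps) / (1 - P.eps) := by rw [hη]; field_simp
      rw [this, div_le_iff₀ (by linarith)]
      nlinarith [mul_nonneg hL0 hε0.le]
    have hη2 : η ≤ 1 := by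
      rw [hη, div_le_one (by linarith)]
      nlinarith
    have h2 := mul_rounding_le hη2 n (2 ^ lam)
    have h3 : 23 * n / ((2 ^ lam : ℕ) : ℝ) =
        n / ((2 ^ lam : ℕ) : ℝ) + 22 * n / ((2 ^ lam : ℕ) : ℝ) := by ring
    rw [mul_add, h3]
    linarith
  · have hcal : P.calibrate = id := if_neg hcase
    refine (stable_of_calibrate_id (P := P) ham hcal hf hfn).mono ?_
    have h1 : n * P.eps ≤ 3 * L / 2 * P.eps := by gcongr; linarith
    have h2 := mul_rounding_le (by linarith : P.eps ≤ 1) n (2 ^ lam)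
    have h3 : (22 * n : ℝ) / ((2 ^ lam : ℕ) : ℝ) ≤ 23 * n / ((2 ^ lam : ℕ) : ℝ) := by
      gcongr; norm_num
    rw [mul_add]
    linarith

/-! ### The execution does not depend on the secrets before they leak -/

lemma step_congr_of_weights_none {P : Protocol n D lam} {σ : State n D lam}
    (h : ∀ i, σ.weights i = none) (ω ω' : Secrets n D lam) (e : Event n) :
    step P ω σ e = step P ω' σ e := by
  unfold step
  split_ifs with he
  · cases e with
    | returnTickets i => obtain ⟨-, -, w, hw, -⟩ := he; simp [h i] at hw
    | returnValues i => obtain ⟨-, -, -, w, hw, -⟩ := he; simp [h i] at hw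
    | _ => rfl
  · rfl

/-- Retrieval is enabled exactly by processes that have weights, so nothing has leaked and the
scheduled event is the same. The conclusion includes the very step in which the first weights
appear. -/
lemma history_succ_congr (hn : 0 < n) {P : Protocol n D lam} {A : Adversary n D lam}
    {ω ω' : Secrets n D lam} {k : ℕ} (h : history P A ω' k = history P A ω k)
    (hnone : ∀ i, (run P A ω k).weights i = none) :
    history P A ω' (k + 1) = history P A ω (k + 1) := by
  have hreach := reachable_run hn P A ω k
  have ht : (run P A ω k).ticketDraw.enabled = ∅ := Finset.eq_empty_of_forall_notMem fun i hi =>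
    (hreach.ticket_enabled i).1 hi (hnone i)
  have hv : (run P A ω k).valueDraw.enabled = ∅ := Finset.eq_empty_of_forall_notMem fun i hi =>
    (hreach.value_enabled i).1 hi (hnone i)
  have ht' : ∀ x : Fin n → Fin (2 ^ lam), (history P A ω k).2.ticketDraw.leak x = none :=
    fun x => if_neg (by change ¬ (run P A ω k).ticketDraw.enabled.Nonempty; simp [ht])
  have hv' : ∀ x : Fin n → Fin D, (history P A ω k).2.valueDraw.leak x = none :=
    fun x => if_neg (by change ¬ (run P A ω k).valueDraw.enabled.Nonempty; simp [hv])
  simp only [history, h, ht', hv']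
  exact congrArg _ (step_congr_of_weights_none hnone ω' ω _)

lemma weights_none_of_le (hn : 0 < n) {P : Protocol n D lam} {A : Adversary n D lam}
    {ω : Secrets n D lam} {k m : ℕ} (hkm : k ≤ m) {i : Fin n}
    (h : (run P A ω m).weights i = none) : (run P A ω k).weights i = none := by
  by_contra hne
  obtain ⟨w, hw⟩ := Option.ne_none_iff_exists'.1 hne
  simp [(extends_run hn P A ω hkm).weights i w hw] at h

lemma history_congr (hn : 0 < n) {P : Protocol n D lam} {A : Adversary n D lam}
    (ω ω' : Secrets n D lam) {k : ℕ} (hnone : ∀ i, (run P A ω k).weights i = none) :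
    history P A ω' k = history P A ω k := by
  induction k with
  | zero => rfl
  | succ k ih =>
    have h := fun i => weights_none_of_le hn (Nat.le_succ k) (hnone i)
    exact history_succ_congr hn (ih h) h

/-- A single event writes the weights of a single process, so the first process to complete is
unique. -/
lemma eq_of_first_weights {P : Protocol n D lam} {ω : Secrets n D lam} {σ : State n D lam}
    (h : ∀ i, σ.weights i = none) {e : Event n} {p q : Fin n}
    (hp : (step P ω σ e).weights p ≠ none) (hq : (step P ω σ e).weights q ≠ none) : p = q := by
  unfold step at hp hq
  split_ifs at hp hq with he
  · cases e <;> simp only [apply] at hp hq <;> grind [Function.update_apply]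
  · exact absurd (h p) hp

/-- The tickets determine which process holds the value of the coin. -/
lemma exists_holder {P : Protocol n D lam} (A : Adversary n D lam) {β : ℝ} (hβ : 0 ≤ β)
    (hfn : 3 * P.f < n) (ham : IsArgmax P.argmax) (hstable : P.Stable β) :
    ∃ g : (Fin n → Fin (2 ^ lam)) → Fin n,
      (∀ ω p v, FirstToComplete (run P A ω) p → Outputs (run P A ω) p v → v = ω.2 (g ω.1)) ∧
      ∃ bad : Finset (Fin n → Fin (2 ^ lam)), (bad.card : ℝ) ≤ β * ((2 ^ lam : ℕ) : ℝ) ^ n ∧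
        ∀ ω : Secrets n D lam, ω.1 ∉ bad → ∀ i v, Outputs (run P A ω) i v → v = ω.2 (g ω.1) := by
  have hn : 0 < n := by omega
  have hreach := reachable_run hn P A
  -- If agreement completes for some secrets, it completes first at the same step, for the same
  -- process and with the same weights for all secrets. Otherwise no secrets ever lead to an output,
  -- and any holder will do.
  by_cases hcomp : ∃ ω k, (∀ i, (run P A ω k).weights i = none) ∧
      ∃ p, (run P A ω (k + 1)).weights p ≠ none
  · obtain ⟨ω₀, k, hnone, p, hp⟩ := hcomp
    obtain ⟨w₀, hw₀⟩ := Option.ne_none_iff_exists'.1 hp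
    have hk : ∀ ω, run P A ω k = run P A ω₀ k := fun ω =>
      congrArg Prod.snd (history_congr hn ω₀ ω hnone)
    have hk1 : ∀ ω, run P A ω (k + 1) = run P A ω₀ (k + 1) := fun ω =>
      congrArg Prod.snd (history_succ_congr hn (history_congr hn ω₀ ω hnone) hnone)
    obtain ⟨C, hC, hadm₀, -⟩ := (hreach ω₀ (k + 1)).weights p w₀ hw₀
    have hcard := (hreach ω₀ (k + 1)).core C hC
    have hCne : C.Nonempty := Finset.card_pos.1 (by omega)
    have hdet : ∀ {ω : Secrets n D lam} {w : Fin n → ℝ} {v : Fin D}, Admissible C w →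
        P.outcome ω w = some v → v = ω.2 (P.select ω.1 w) := by
      intro ω w v hw hv
      rw [P.outcome_eq ham ω (hw.candidates_nonempty hCne)] at hv
      exact (Option.some.inj hv).symm
    obtain ⟨bad, hbad, hsel⟩ := hstable C w₀ hcard hadm₀
    refine ⟨fun T => P.select T w₀, fun ω q v hq hv => ?_, bad, hbad, fun ω hω i v hv => ?_⟩
    · obtain ⟨k', hnone', hq'⟩ := hq
      have hkk : k' = k := by
        rcases lt_trichotomy k' k with h | h | h
        · exact absurd (weights_none_of_le hn h ((hk ω).symm ▸ hnone q)) hq'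
        · exact h
        · refine absurd (weights_none_of_le hn h (hnone' p)) ?_
          rw [hk1 ω]; exact hp
      subst hkk
      have hqp : q = p := by
        rw [hk1 ω, run_succ] at hq'
        rw [run_succ] at hp
        exact eq_of_first_weights hnone hq' hp
      subst hqp
      obtain ⟨m, hm⟩ := hv
      obtain ⟨w, hw, ho⟩ := (hreach ω m).exists_weights_of_output hm
      have h1 := (extends_run hn P A ω (le_max_left m (k' + 1))).weights q w hw
      have h2 := (extends_run hn P A ω (le_max_right m (k' + 1))).weights q w₀
        (by rw [hk1 ω]; exact hw₀)
      obtain rfl : w = w₀ := Option.some.inj (h1.symm.trans h2)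
      exact hdet hadm₀ ho
    -- The weights of `i` and `w₀` are compared at a common later state: there they are ε-close, and
    -- both are admissible for the same core, which never changes.
    · obtain ⟨m, hm⟩ := hv
      obtain ⟨w, hw, ho⟩ := (hreach ω m).exists_weights_of_output hm
      have h1 := (extends_run hn P A ω (le_max_left m (k + 1))).weights i w hw
      have hext := extends_run hn P A ω (le_max_right m (k + 1))
      have h2 := hext.weights p w₀ (by rw [hk1 ω]; exact hw₀)
      have h3 := hext.core C (by rw [hk1 ω]; exact hC)
      obtain ⟨C', hC', hadm, -⟩ := (hreach ω _).weights i w h1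
      obtain rfl : C = C' := Option.some.inj (h3.symm.trans hC')
      exact (hdet hadm ho).trans
        (congrArg ω.2 (hsel ω.1 hω w hadm ((hreach ω _).close i p w w₀ h1 h2)))
  · have hnever : ∀ ω k i, (run P A ω k).weights i = none := by
      intro ω k
      induction k with
      | zero => exact fun _ => rfl
      | succ k ih =>
        intro i
        by_contra h
        exact hcomp ⟨ω, k, ih, i, h⟩
    have hout : ∀ ω i v, ¬ Outputs (run P A ω) i v := by
      rintro ω i v ⟨m, hm⟩
      obtain ⟨w, hw, -⟩ := (hreach ω m).exists_weights_of_output hm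
      simp [hnever ω m i] at hw
    exact ⟨fun _ => ⟨0, hn⟩, fun ω p v _ h => absurd h (hout ω p v), ∅,
      by simpa using by positivity, fun ω _ i v h => absurd h (hout ω i v)⟩

/-! ### Probabilities -/

section Probability

/-- The fraction of the secrets with a given property. -/
noncomputable def freq (E : Secrets n D lam → Prop) : ℝ :=
  open Classical in
  ((Finset.univ.filter E).card : ℝ) / Fintype.card (Secrets n D lam)

lemma freq_eq (E : Secrets n D lam → Prop) [DecidablePred E] :
    freq E = ((Finset.univ.filter E).card : ℝ) / Fintype.card (Secrets n D lam) := by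
  unfold freq
  congr!

lemma card_secrets : (Fintype.card (Secrets n D lam) : ℝ) =
    ((2 ^ lam : ℕ) : ℝ) ^ n * (D : ℝ) ^ n := by
  simp [Secrets]

variable [NeZero D]

lemma card_secrets_pos : (0 : ℝ) < Fintype.card (Secrets n D lam) := by
  exact_mod_cast Fintype.card_pos

lemma freq_nonneg (E : Secrets n D lam → Prop) : 0 ≤ freq E := by
  unfold freq; positivity

lemma freq_mono {E F : Secrets n D lam → Prop} (h : ∀ ω, E ω → F ω) : freq E ≤ freq F := by
  unfold freq
  gcongr with ω
  exact h ω

lemma freq_le_add {E F G : Secrets n D lam → Prop} (h : ∀ ω, E ω → F ω ∨ G ω) :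
    freq E ≤ freq F + freq G := by
  classical
  unfold freq
  rw [← add_div]
  gcongr
  have : Finset.univ.filter E ⊆ Finset.univ.filter F ∪ Finset.univ.filter G := by
    intro ω hω
    simpa using h ω (by simpa using hω)
  exact_mod_cast (Finset.card_le_card this).trans (Finset.card_union_le _ _)

lemma freq_true : freq (fun _ : Secrets n D lam => True) = 1 := by
  unfold freq
  simp only [Finset.filter_true, Finset.card_univ]
  exact div_self card_secrets_pos.ne'

lemma freq_le_one (E : Secrets n D lam → Prop) : freq E ≤ 1 :=
  (freq_mono fun _ _ => trivial).trans freq_true.le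

lemma freq_bad_le {bad : Finset (Fin n → Fin (2 ^ lam))} {β : ℝ}
    (h : (bad.card : ℝ) ≤ β * ((2 ^ lam : ℕ) : ℝ) ^ n) :
    freq (fun ω : Secrets n D lam => ω.1 ∈ bad) ≤ β := by
  classical
  have hset : (Finset.univ.filter fun ω : Secrets n D lam => ω.1 ∈ bad) =
      bad ×ˢ Finset.univ := by
    ext ω; simp
  rw [freq_eq, div_le_iff₀ card_secrets_pos]
  have hcard : ((Finset.univ.filter fun ω : Secrets n D lam => ω.1 ∈ bad).card : ℝ) =
      bad.card * (D : ℝ) ^ n := by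
    have : (Finset.univ.filter fun ω : Secrets n D lam => ω.1 ∈ bad).card =
        bad.card * D ^ n := by
      rw [hset, Finset.card_product]; simp
    exact_mod_cast this
  calc _ = bad.card * (D : ℝ) ^ n := by rw [← hcard]
    _ ≤ β * ((2 ^ lam : ℕ) : ℝ) ^ n * (D : ℝ) ^ n := by gcongr
    _ = _ := by rw [card_secrets, mul_assoc]

/-- A value held by a process chosen by means of the tickets is uniform. -/
lemma freq_value_eq (g : (Fin n → Fin (2 ^ lam)) → Fin n) (v : Fin D) :
    freq (fun ω : Secrets n D lam => ω.2 (g ω.1) = v) = 1 / (D : ℝ) := by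
  classical
  have hD : (0 : ℝ) < D := by exact_mod_cast Nat.pos_of_neZero D
  have hfib : ∀ i : Fin n,
      ((Finset.univ.filter fun V : Fin n → Fin D => V i = v).card : ℝ) * D = (D : ℝ) ^ n := by
    intro i
    have h := card_box (n := n) (N := D) {i} (fun l => if l = i then {v} else Finset.univ)
      (fun l hl => if_neg (by simpa using hl))
    have hset : (Finset.univ.filter fun V : Fin n → Fin D => V i = v) =
        Fintype.piFinset (fun l => if l = i then {v} else Finset.univ) := by
      ext V
      simp only [Finset.mem_filter, Finset.mem_univ, true_and, Fintype.mem_piFinset]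
      refine ⟨fun hV l => ?_, fun hV => by simpa using hV i⟩
      by_cases hl : l = i
      · subst hl; simpa using hV
      · simp [hl]
    rw [hset]
    simpa using h
  have hsum : (Finset.univ.filter fun ω : Secrets n D lam => ω.2 (g ω.1) = v).card =
      ∑ T : Fin n → Fin (2 ^ lam),
        (Finset.univ.filter fun V : Fin n → Fin D => V (g T) = v).card := by
    rw [← Finset.card_sigma]
    refine Finset.card_bij (fun ω _ => ⟨ω.1, ω.2⟩) (fun ω hω => by simpa using hω) ?_ ?_
    · rintro ⟨T, V⟩ _ ⟨T', V'⟩ _ h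
      simpa using h
    · rintro ⟨T, V⟩ h
      exact ⟨(T, V), by simpa using h, rfl⟩
  have hcard : ((Finset.univ.filter fun ω : Secrets n D lam => ω.2 (g ω.1) = v).card : ℝ) * D =
      Fintype.card (Secrets n D lam) := by
    rw [hsum, Nat.cast_sum, Finset.sum_mul, Finset.sum_congr rfl fun T _ => hfib (g T),
      card_secrets]
    simp
  rw [freq_eq, div_eq_div_iff card_secrets_pos.ne' hD.ne', one_mul, ← hcard]

/-- A randomized adversary is an average of deterministic ones, so bounds on `freq` that are uniform
in the seed pass to `prob`. -/
lemma prob_eq_tsum {Seed : Type} (ρ : PMF Seed) (E : Seed → Secrets n D lam → Prop) :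
    prob ρ E = ∑' s, (ρ s).toReal * freq (E s) := by
  classical
  unfold prob law
  rw [PMF.toOuterMeasure_bind_apply, ENNReal.tsum_toReal_eq]
  · refine tsum_congr fun s => ?_
    rw [ENNReal.toReal_mul, PMF.toOuterMeasure_map_apply,
      PMF.toOuterMeasure_uniformOfFintype_apply, ENNReal.toReal_div, ENNReal.toReal_natCast,
      ENNReal.toReal_natCast, freq_eq, Fintype.card_subtype]
    rfl
  · intro s
    refine ENNReal.mul_ne_top (PMF.apply_ne_top ρ s) ?_
    rw [PMF.toOuterMeasure_map_apply, PMF.toOuterMeasure_uniformOfFintype_apply]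
    exact ENNReal.div_ne_top (ENNReal.natCast_ne_top _)
      (Nat.cast_ne_zero.2 Fintype.card_ne_zero)

lemma hasSum_pmf {Seed : Type} (ρ : PMF Seed) : HasSum (fun s => (ρ s).toReal) 1 := by
  have h := ρ.tsum_coe
  have hs : Summable fun s => (ρ s).toReal := ENNReal.summable_toReal (by rw [h]; simp)
  have : ∑' s, (ρ s).toReal = 1 := by
    rw [← ENNReal.tsum_toReal_eq (PMF.apply_ne_top ρ), h, ENNReal.toReal_one]
  exact this ▸ hs.hasSum

lemma summable_mul_freq {Seed : Type} (ρ : PMF Seed) (E : Seed → Secrets n D lam → Prop) :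
    Summable fun s => (ρ s).toReal * freq (E s) :=
  (hasSum_pmf ρ).summable.of_nonneg_of_le (fun s => mul_nonneg (by positivity) (freq_nonneg _))
    fun s => mul_le_of_le_one_right (by positivity) (freq_le_one _)

lemma prob_le {Seed : Type} {ρ : PMF Seed} {E : Seed → Secrets n D lam → Prop} {b : ℝ}
    (h : ∀ s, freq (E s) ≤ b) : prob ρ E ≤ b := by
  rw [prob_eq_tsum]
  have := (summable_mul_freq ρ E).hasSum
  refine (hasSum_le (fun s => ?_) this ((hasSum_pmf ρ).mul_right b)).trans_eq (one_mul b)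
  exact mul_le_mul_of_nonneg_left (h s) (by positivity)

lemma le_prob {Seed : Type} {ρ : PMF Seed} {E : Seed → Secrets n D lam → Prop} {b : ℝ}
    (h : ∀ s, b ≤ freq (E s)) : b ≤ prob ρ E := by
  rw [prob_eq_tsum]
  have := (summable_mul_freq ρ E).hasSum
  refine (one_mul b).symm.trans_le (hasSum_le (fun s => ?_) ((hasSum_pmf ρ).mul_right b) this)
  exact mul_le_mul_of_nonneg_left (h s) (by positivity)

/-- A protocol with stable selection is a common coin. -/
theorem isCommonCoin_of_stable {P : Protocol n D lam} {δ loss : ℝ} (hβ : 0 ≤ 1 - δ + loss)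
    (hfn : 3 * P.f < n) (ham : IsArgmax P.argmax) (hstable : P.Stable (1 - δ + loss)) :
    IsCommonCoin P δ loss := by
  have hn : 0 < n := by omega
  have hterm : ∀ (A : Adversary n D lam) (ω : Secrets n D lam), Fair (run P A ω) →
      ∀ i ∈ Correct (run P A ω), ∃ v, Outputs (run P A ω) i v := by
    rintro A ω ⟨⟨k, hk⟩, hlive⟩ i hi
    obtain ⟨-, -, -, -, -, k₆, -, -, -, -, -, -, hout⟩ :=
      exists_output_of_live isDeadline_eventually hfn ham hlive hk
    obtain ⟨v, hv⟩ := hout i hi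
    exact ⟨v, k₆, hv⟩
  choose g hfirst bad hbad hgood using
    fun A : Adversary n D lam => exists_holder A hβ hfn ham hstable
  have hbadfreq : ∀ A, freq (fun ω : Secrets n D lam => ω.1 ∈ bad A) ≤ 1 - δ + loss :=
    fun A => freq_bad_le (hbad A)
  have hlarge : ∀ A (E : Secrets n D lam → Prop), (∀ ω, ω.1 ∉ bad A → E ω) →
      δ - loss ≤ freq E := by
    intro A E hE
    have h1 : freq (fun _ : Secrets n D lam => True) ≤
        freq E + freq (fun ω : Secrets n D lam => ω.1 ∈ bad A) :=
      freq_le_add fun ω _ => by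
        by_cases h : ω.1 ∈ bad A
        · exact Or.inr h
        · exact Or.inl (hE ω h)
    rw [freq_true] at h1
    linarith [hbadfreq A]
  refine ⟨hterm, fun Seed ρ A => ?_, fun Seed ρ A => ?_⟩
  · refine le_prob fun s => hlarge (A s) _ fun ω hω i _ j _ u v hu hv => ?_
    rw [hgood (A s) ω hω i u hu, hgood (A s) ω hω j v hv]
  · have huniform : ∀ s v, freq (fun ω : Secrets n D lam => ω.2 (g (A s) ω.1) = v) =
        1 / (D : ℝ) := fun s v => freq_value_eq _ v
    refine ⟨fun s ω => ω.2 (g (A s) ω.1), fun s v => ?_, fun v => ?_,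
      fun s ω p v => hfirst (A s) ω p v,
      le_prob fun s => hlarge (A s) _ fun ω hω i v => hgood (A s) ω hω i v,
      fun hfair i hi v => ?_⟩
    · exact le_antisymm (prob_le fun s => (huniform s v).le) (le_prob fun s => (huniform s v).ge)
    · exact le_antisymm (prob_le fun s => (huniform s v).le) (le_prob fun s => (huniform s v).ge)
    · rw [abs_le]
      constructor
      -- Termination enters only in this direction: off the bad tickets process `i` outputs
      -- something, and that output is the coin.
      · suffices H : 1 / (D : ℝ) - (1 - δ + loss) ≤
            prob ρ (fun s ω => Outputs (run P (A s) ω) i v) by linarith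
        refine le_prob fun s => ?_
        have h1 : freq (fun ω : Secrets n D lam => ω.2 (g (A s) ω.1) = v) ≤
            freq (fun ω => Outputs (run P (A s) ω) i v) +
              freq (fun ω : Secrets n D lam => ω.1 ∈ bad (A s)) :=
          freq_le_add fun ω hω => by
            by_cases h : ω.1 ∈ bad (A s)
            · exact Or.inr h
            · obtain ⟨u, hu⟩ := hterm (A s) ω (hfair s ω) i (hi s ω)
              have huv : u = v := (hgood (A s) ω h i u hu).trans hω
              exact Or.inl (huv ▸ hu)
        rw [huniform] at h1
        linarith [hbadfreq (A s)]
      · suffices H : prob ρ (fun s ω => Outputs (run P (A s) ω) i v) ≤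
            1 / (D : ℝ) + (1 - δ + loss) by linarith
        refine prob_le fun s => ?_
        have h1 : freq (fun ω => Outputs (run P (A s) ω) i v) ≤
            freq (fun ω : Secrets n D lam => ω.2 (g (A s) ω.1) = v) +
              freq (fun ω : Secrets n D lam => ω.1 ∈ bad (A s)) :=
          freq_le_add fun ω hω => by
            by_cases h : ω.1 ∈ bad (A s)
            · exact Or.inr h
            · exact Or.inl (hgood (A s) ω h i v hω).symm
        rw [huniform] at h1
        linarith [hbadfreq (A s)]

end Probability

/-! ### Complexity -/

lemma one_le_logb {δ : ℝ} (hδ : 1 / 2 ≤ δ) (hδ1 : δ < 1) : 1 ≤ Real.logb 2 (1 / (1 - δ)) := by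
  have h0 : 0 < 1 - δ := by linarith
  rw [Real.le_logb_iff_rpow_le (by norm_num) (by positivity), Real.rpow_one,
    le_div_iff₀ h0]
  linarith

/-- For ℓ ≥ 1 the number of rounds is at most 6 + ℓ + log₂ ℓ ≤ 6 + 2ℓ ≤ 8ℓ. -/
lemma calibratedRounds_le {δ : ℝ} (hδ : 1 / 2 ≤ δ) (hδ1 : δ < 1) :
    (calibratedRounds δ : ℝ) ≤ 8 * Real.logb 2 (1 / (1 - δ)) := by
  have hℓ := one_le_logb hδ hδ1
  unfold calibratedRounds
  set ℓ := Real.logb 2 (1 / (1 - δ))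
  have hlog0 : 0 ≤ Real.logb 2 ℓ := Real.logb_nonneg (by norm_num) hℓ
  have hlog : Real.logb 2 ℓ ≤ ℓ := by
    rw [Real.logb_le_iff_le_rpow (by norm_num) (by linarith)]
    -- Bernoulli: 1 + ℓ ≤ 2^ℓ, hence log₂ ℓ ≤ ℓ.
    have h1 := one_add_mul_self_le_rpow_one_add (s := 1) (by norm_num) hℓ
    norm_num at h1
    linarith
  have hceil := Int.ceil_lt_add_one (ℓ + Real.logb 2 ℓ)
  have hnn : (0 : ℤ) ≤ 5 + ⌈ℓ + Real.logb 2 ℓ⌉ := by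
    have : 0 ≤ ⌈ℓ + Real.logb 2 ℓ⌉ := Int.ceil_nonneg (by linarith)
    omega
  have hcast : (((5 + ⌈ℓ + Real.logb 2 ℓ⌉).toNat : ℕ) : ℝ) = 5 + (⌈ℓ + Real.logb 2 ℓ⌉ : ℝ) := by
    have : (((5 + ⌈ℓ + Real.logb 2 ℓ⌉).toNat : ℕ) : ℤ) = 5 + ⌈ℓ + Real.logb 2 ℓ⌉ :=
      Int.toNat_of_nonneg hnn
    exact_mod_cast congrArg (Int.cast : ℤ → ℝ) this
  rw [Nat.cast_max, hcast]
  refine max_le ?_ ?_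
  · push_cast; linarith
  · linarith

/-- The six phases cost two draw latencies, one Gather, all agreement rounds and two retrievals. The
constant ones are absorbed by ℓ ≥ 1. -/
lemma timeBound_calibrated (c : Costs) {f : ℕ} {δ : ℝ}
    {am : Finset (Fin n) → (Fin n → ℝ) → Fin n} (hfn : 3 * f < n) (hδ : 1 / 2 ≤ δ)
    (hδ1 : δ < 1) (ham : IsArgmax am) {K : ℝ}
    (hK : 2 * c.rsdLatency + c.gatherLatency + 8 * c.baaLatency + 2 * c.retrieveLatency ≤ K) :
    TimeBound c (calibrated n D lam f am δ) (K * Real.logb 2 (1 / (1 - δ))) := by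
  intro A ω τ _ hlive k hstart i hi
  set P := calibrated n D lam f am δ with hP
  obtain ⟨k₁, k₂, k₃, k₄, k₅, k₆, h₁, h₂, h₃, h₄, h₅, h₆, hout⟩ :=
    exists_output_of_live (isDeadline_timely c P τ) hfn ham hlive hstart
  obtain ⟨v, hv⟩ := hout i hi
  refine ⟨k₆, v, ?_, hv⟩
  have hr : (P.rounds : ℝ) ≤ 8 * Real.logb 2 (1 / (1 - δ)) := calibratedRounds_le hδ hδ1
  have hℓ := one_le_logb hδ hδ1
  have e₁ := h₁.2
  have e₂ := h₂.2
  have e₃ := h₃.2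
  have e₄ := h₄.2
  have e₅ := h₅.2
  have e₆ := h₆.2
  simp only [latency, Nat.cast_mul] at e₁ e₂ e₃ e₄ e₅ e₆
  set ℓ := Real.logb 2 (1 / (1 - δ))
  have hbaa : (c.baaLatency : ℝ) * P.rounds ≤ c.baaLatency * (8 * ℓ) := by gcongr
  have hrest : 2 * (c.rsdLatency : ℝ) + c.gatherLatency + 2 * c.retrieveLatency ≤
      (2 * c.rsdLatency + c.gatherLatency + 2 * c.retrieveLatency) * ℓ :=
    le_mul_of_one_le_right (by positivity) hℓ
  have hKℓ : (2 * c.rsdLatency + c.gatherLatency + 8 * c.baaLatency + 2 * c.retrieveLatency) * ℓ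
      ≤ K * ℓ := by gcongr
  linarith

/-- This is where D ≤ 2^(nλ) matters: sharing values then costs no more than the order n²λ of the
other operations. -/
lemma shareBits_le {N : ℕ} (h : N ≤ 2 ^ (n * lam)) : shareBits n lam N ≤ 2 * (n ^ 2 * lam) := by
  have : Nat.clog 2 N ≤ n * lam := (Nat.clog_le_iff_le_pow (by norm_num)).2 h
  unfold shareBits
  nlinarith

lemma communicationBound_calibrated (c : Costs) {f : ℕ} {δ : ℝ}
    {am : Finset (Fin n) → (Fin n → ℝ) → Fin n} (hn : 0 < n) (hδ : 1 / 2 ≤ δ) (hδ1 : δ < 1)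
    (hD : D ≤ 2 ^ (n * lam)) {K : ℝ}
    (hK : 4 * c.rsdBits + c.gatherBits + 8 * c.baaBits + 4 * c.retrieveBits ≤ K) :
    CommunicationBound c (calibrated n D lam f am δ)
      (K * (n ^ 3 * lam * Real.logb 2 (1 / (1 - δ)))) := by
  intro A ω k
  set P := calibrated n D lam f am δ with hP
  set σ := run P A ω k
  have hr : (P.rounds : ℝ) ≤ 8 * Real.logb 2 (1 / (1 - δ)) := calibratedRounds_le hδ hδ1
  have hℓ := one_le_logb hδ hδ1
  set ℓ := Real.logb 2 (1 / (1 - δ))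
  have ht : shareBits n lam (2 ^ lam) ≤ 2 * (n ^ 2 * lam) :=
    shareBits_le (Nat.pow_le_pow_right (by norm_num) (Nat.le_mul_of_pos_left lam hn))
  have hd := shareBits_le hD
  set u := n ^ 2 * lam with hu
  have h1 : communication c P σ ≤
      n * (c.rsdBits * (2 * u) + c.rsdBits * (2 * u) + c.gatherBits * u +
        P.rounds * (c.baaBits * u) + c.retrieveBits * (2 * u) + c.retrieveBits * (2 * u)) := by
    have hite : ∀ (p : Prop) [Decidable p] (a b : ℕ), a ≤ b → (if p then a else 0) ≤ b := by
      intro p _ a b hab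
      split_ifs
      · exact hab
      · exact Nat.zero_le b
    unfold communication
    refine (Finset.sum_le_card_nsmul _ _ (c.rsdBits * (2 * u) + c.rsdBits * (2 * u) +
      c.gatherBits * u + P.rounds * (c.baaBits * u) + c.retrieveBits * (2 * u) +
      c.retrieveBits * (2 * u)) fun i _ => ?_).trans (by simp)
    refine add_le_add (add_le_add (add_le_add ?_ ?_) ?_) ?_ <;> apply hite
    · gcongr
    · exact le_rfl
    · gcongr
    · gcongr
  have h2 : (communication c P σ : ℝ) ≤
      n * (c.rsdBits * (2 * u) + c.rsdBits * (2 * u) + c.gatherBits * u +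
        P.rounds * (c.baaBits * u) + c.retrieveBits * (2 * u) + c.retrieveBits * (2 * u)) := by
    exact_mod_cast h1
  have hrest : (4 * c.rsdBits + c.gatherBits + 4 * c.retrieveBits : ℝ) ≤
      (4 * c.rsdBits + c.gatherBits + 4 * c.retrieveBits) * ℓ :=
    le_mul_of_one_le_right (by positivity) hℓ
  have hbaa : (P.rounds : ℝ) * c.baaBits ≤ 8 * ℓ * c.baaBits := by gcongr
  calc (communication c P σ : ℝ)
      ≤ n * u * (4 * c.rsdBits + c.gatherBits + 4 * c.retrieveBits + P.rounds * c.baaBits) := by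
        refine h2.trans (le_of_eq ?_); ring
    _ ≤ n * u * ((4 * c.rsdBits + c.gatherBits + 4 * c.retrieveBits) * ℓ +
          8 * ℓ * c.baaBits) := by gcongr
    _ = (4 * c.rsdBits + c.gatherBits + 8 * c.baaBits + 4 * c.retrieveBits) *
          (n * u * ℓ) := by ring
    _ ≤ K * (n * u * ℓ) := by gcongr
    _ = K * (n ^ 3 * lam * ℓ) := by rw [hu]; push_cast; ring

end MonteCarloCoin

/-! ### Choice of the constants. -/

theorem mainTheorem2 :
    (∃ K : ℝ, ∀ (n f D lam : ℕ) [NeZero D] (δ : ℝ)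
      (am : Finset (Fin n) → (Fin n → ℝ) → Fin n),
      3 * f < n → 0 < δ → δ < 1 → MonteCarloCoin.IsArgmax am →
        MonteCarloCoin.IsCommonCoin (MonteCarloCoin.calibrated n D lam f am δ) δ
          (K * n ^ 2 / 2 ^ lam) ∧
        MonteCarloCoin.IsCommonCoin (MonteCarloCoin.uncalibrated n D lam f am δ) δ
          (K * n ^ 2 / 2 ^ lam)) ∧
    (∀ c : MonteCarloCoin.Costs, ∃ C : ℝ, ∀ (n f D lam : ℕ) (δ : ℝ)
      (am : Finset (Fin n) → (Fin n → ℝ) → Fin n),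
      3 * f < n → 1 / 2 ≤ δ → δ < 1 → MonteCarloCoin.IsArgmax am →
        MonteCarloCoin.TimeBound c (MonteCarloCoin.calibrated n D lam f am δ)
          (C * Real.logb 2 (1 / (1 - δ))) ∧
        (D ≤ 2 ^ (n * lam) →
          MonteCarloCoin.CommunicationBound c (MonteCarloCoin.calibrated n D lam f am δ)
            (C * (n ^ 3 * lam * Real.logb 2 (1 / (1 - δ)))))) := by
  constructor
  · refine ⟨23, fun n f D lam _ δ am hfn hδ0 hδ1 ham => ?_⟩
    have hδ : 0 < 1 - δ := by linarith
    have hn : (1 : ℝ) ≤ n := by exact_mod_cast (by omega : 1 ≤ n)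
    -- The argument gives a loss linear in n; it is weakened to n² by n ≤ n².
    have hloss : 1 - δ + 23 * (n : ℝ) / ((2 ^ lam : ℕ) : ℝ) ≤
        1 - δ + 23 * (n : ℝ) ^ 2 / 2 ^ lam := by
      push_cast
      gcongr
      exact le_self_pow₀ hn (by norm_num)
    exact ⟨MonteCarloCoin.isCommonCoin_of_stable (by positivity) hfn ham
        ((MonteCarloCoin.stable_calibrated hfn hδ0 hδ1 ham).mono hloss),
      MonteCarloCoin.isCommonCoin_of_stable (by positivity) hfn ham
        ((MonteCarloCoin.stable_uncalibrated hfn hδ1 ham).mono hloss)⟩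
  · intro c
    refine ⟨max (2 * c.rsdLatency + c.gatherLatency + 8 * c.baaLatency + 2 * c.retrieveLatency)
      (4 * c.rsdBits + c.gatherBits + 8 * c.baaBits + 4 * c.retrieveBits),
      fun n f D lam δ am hfn hδ hδ1 ham => ⟨?_, fun hD => ?_⟩⟩
    · exact MonteCarloCoin.timeBound_calibrated c hfn hδ hδ1 ham (le_max_left _ _)
    · exact MonteCarloCoin.communicationBound_calibrated c (by omega) hδ hδ1 hD (le_max_right _ _)
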